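/- All structures are finite. Let $p$ be a prime and let $\mathcal H=(H;R_1,\dots,R_\ell)$ be a single-sorted relational structure with $|H|=3$ whose relations include all the constant relations $\{a\}$, $a\in H$. Definitions. A relation $R(x_1,\dots,x_k)$ on $H$ is *$p$-mpp-definable* in $\mathcal H$ if there is a conjunction $\Phi(x_1,\dots,x_k,y_1,\dots,y_s)$ of equalities of variables and of relations of $\mathcal H$ applied to variables such that $R(\mathbf a)$ holds if and only if the number of $\mathbf b\in H^s$ with $\Phi(\mathbf a,\mathbf b)$ is not divisible by $p$. Let $\langle\mathcal H\rangle_p$ be the set of all such relations. A *$p$-subalgebra* is a subset of $H$ that is $p$-mpp-definable as a unary relation. An operation $f$ on $H$ is a *polymorphism* of a set of relations (or of $\mathcal H$, meaning of its relations) if, applied coordinatewise to tuples of a relation in the set, it gives a tuple of that relation; a ternary operation $m$ is *Mal'tsev* if $m(x,y,y)=m(y,y,x)=x$ for all $x,y$. A relation $R$ of arity $n\ge 2$ is *rectangular* if for every partition of its coordinates into two parts, $(\mathbf a,\mathbf c),(\mathbf a,\mathbf d),(\mathbf b,\mathbf c)\in R$ implies $(\mathbf b,\mathbf d)\in R$;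 $\mathcal H$ is *strongly $p$-rectangular* if all relations of arity at least $2$ in $\langle\mathcal H\rangle_p$ are rectangular. A *$p$-automorphic polynomial* of $\mathcal H$ is a binary polymorphism $f$ of $\mathcal H$ such that for every $a\in H$ the map $x\mapsto f(a,x)$ is the identity or a permutation of $H$ of order $p$, and it is of order $p$ for at least one $a$. For every ternary polymorphism $f$ of $\mathcal H$ that is not a polymorphism of $\langle\mathcal H\rangle_p$ fix a relation $Q_f\in\langle\mathcal H\rangle_p$ that $f$ does not preserve, and let $\mathcal H^{\dagger p}$ be the expansion of $\mathcal H$ by all these $Q_f$. Let $\Upsilon_3(\mathcal H^{\dagger p})$ be the relation, with coordinates indexed by $H^3$, of all maps $\varphi:H^3\to H$ such that for every relation $R$ of $\mathcal H^{\dagger p}$, of arity $n$ say, and all $z_1,\dots,z_n\in H^3$ with $(z_1[t],\dots,z_n[t])\in R$ for $t=1,2,3$, one has $(\varphi(z_1),\dots,\varphi(z_n))\in R$. Let $I=\{(a,b,b): a,b\in H\}$ and $J=\{(c,c,d): c,d\in H,\ c\neq d\}$. Let $\mathbf a,\mathbf b$ be the tuples indexed by $I$ whose entries at $(a,b,b)$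 are $a$ and $b$, respectively, and let $\mathbf c,\mathbf d$ be the tuples indexed by $J$ whose entries at $(c,c,d)$ are $c$ and $d$, respectively. A *$p$-indicator rectangularity obstruction* is a relation $R\subseteq \mathrm{pr}_{I\cup J}\Upsilon_3(\mathcal H^{\dagger p})$ such that $(\mathbf a,\mathbf c),(\mathbf b,\mathbf c),(\mathbf b,\mathbf d)\in R$ and $(\mathbf a,\mathbf d)\notin R$; $\mathcal H$ *admits* such an obstruction if some such $R$ is $p$-mpp-definable in $\mathcal H$. Theorem. At least one of the following holds: 1. $\langle\mathcal H\rangle_p$ has a Mal'tsev polymorphism, and therefore $\mathcal H$ is strongly $p$-rectangular; 2. $\mathcal H$ admits a $p$-indicator rectangularity obstruction; 3. $p=2$, and $\mathcal H$ has a $2$-automorphic polynomial $f$ for which there is $a\in H$ such that $x\mapsto f(a,x)$ is a permutation of order $2$ and $H\setminus\{a\}$ is a $2$-subalgebra of $\mathcal H$. -/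

import Mathlib

/-!
A single-sorted relational structure is a Mathlib first-order structure `A` over a language `L`
without function symbols.
-/

universe u v w

namespace ModCSP

/-! ### Modular primitive positive definability -/

/-- Atomic formulas over the variables `V`: equalities of variables and relations of the structure
applied to variables. -/
inductive Atom (L : FirstOrder.Language.{u, v}) (V : Type w) : Type (max v w)
  | eq (x y : V) : Atom L V
  | rel {n : ℕ} (R : L.Relations n) (x : Fin n → V) : Atom L V

/-- Truth of an atomic formula under an assignment of the variables. -/
def Atom.Holds {L : FirstOrder.Language.{u, v}} {V : Type*} {A : Type w} [L.Structure A]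
    (φ : V → A) : Atom L V → Prop
  | .eq x y => φ x = φ y
  | .rel R x => FirstOrder.Language.Structure.RelMap R (fun i => φ (x i))

/-- For a conjunction `Φ(x, y)` of atomic formulas with free variables `x` indexed by `ι` and
quantified variables `y₁, …, yₛ`, the number of assignments `b` to the `y`'s such that
`Φ(a, b)` is true. -/
noncomputable def numExt {L : FirstOrder.Language.{u, v}} {A : Type w} [L.Structure A]
    {ι : Type*} {s : ℕ} (Φ : List (Atom L (ι ⊕ Fin s))) (a : ι → A) : ℕ :=
  Nat.card {b : Fin s → A // ∀ α ∈ Φ, α.Holds (Sum.elim a b)}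

/-- The relation `R`, with coordinates indexed by `ι`, is `p`-mpp-definable in the structure `A`:
`R(x) = ∃^{≡ p} y₁, …, yₛ Φ(x, y)`, which is true iff the number of extensions is nonzero
modulo `p`. -/
def MppDefinable (p : ℕ) (L : FirstOrder.Language.{u, v}) {A : Type w} [L.Structure A]
    {ι : Type*} (R : Set (ι → A)) : Prop :=
  ∃ (s : ℕ) (Φ : List (Atom L (ι ⊕ Fin s))), ∀ a : ι → A, a ∈ R ↔ ¬ numExt Φ a ≡ 0 [MOD p]

/-- A finitary relation on `A`, of arbitrary arity. -/
abbrev FinRel (A : Type w) : Type w := Σ n : ℕ, Set (Fin n → A)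

/-- The set of relations `Γ_H` of the structure. -/
def basicRelations (L : FirstOrder.Language.{u, v}) (A : Type w) [L.Structure A] : Set (FinRel A) :=
  {R | ∃ S : L.Relations R.1, R.2 = {x | FirstOrder.Language.Structure.RelMap S x}}

/-- The set `⟨H⟩_p` of all relations that are `p`-mpp-definable in the structure. -/
def mppRelations (p : ℕ) (L : FirstOrder.Language.{u, v}) (A : Type w) [L.Structure A] :
    Set (FinRel A) :=
  {R | MppDefinable p L R.2}

/-- A `p`-subalgebra: a subset that is `p`-mpp-definable as a unary relation. -/
def IsPSubalgebra (p : ℕ) (L : FirstOrder.Language.{u, v}) {A : Type w} [L.Structure A]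
    (B : Set A) : Prop :=
  MppDefinable p L {x : Fin 1 → A | x 0 ∈ B}

/-- The structure contains all the constant relations `{a}`. -/
def HasConstants (L : FirstOrder.Language.{u, v}) (A : Type w) [L.Structure A] : Prop :=
  ∀ a : A, ∃ C : L.Relations 1, ∀ x : Fin 1 → A, FirstOrder.Language.Structure.RelMap C x ↔ x 0 = a

/-! ### Polymorphisms and rectangularity -/

/-- The `r`-ary operation `f` is a polymorphism of every relation in `Γ`. -/
def IsPolymorphism {A : Type w} {r : ℕ} (f : (Fin r → A) → A) (Γ : Set (FinRel A)) : Prop :=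
  ∀ R ∈ Γ, ∀ t : Fin r → Fin R.1 → A, (∀ j, t j ∈ R.2) → (fun i => f (fun j => t j i)) ∈ R.2

/-- The set of relations `Γ` has a Mal'tsev polymorphism. -/
def HasMaltsevPolymorphism {A : Type w} (Γ : Set (FinRel A)) : Prop :=
  ∃ m : (Fin 3 → A) → A, IsPolymorphism m Γ ∧ ∀ x y : A, m ![x, y, y] = x ∧ m ![y, y, x] = x

open Classical in
/-- A relation is rectangular: for every set `I` of coordinates it is rectangular when viewed as
a binary relation between tuples on `I` and tuples on the complement of `I`.
Here `I.piecewise a c` is the tuple `(a, c)` that agrees with `a` on `I` and with `c` off `I`. -/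
def Rectangular {A : Type w} {n : ℕ} (R : Set (Fin n → A)) : Prop :=
  ∀ (I : Set (Fin n)) (a b c d : Fin n → A),
    I.piecewise a c ∈ R → I.piecewise a d ∈ R → I.piecewise b c ∈ R → I.piecewise b d ∈ R

/-- Every relation of arity at least 2 in `⟨H⟩_p` is rectangular. -/
def StronglyPRectangular (p : ℕ) (L : FirstOrder.Language.{u, v}) (A : Type w)
    [L.Structure A] : Prop :=
  ∀ R ∈ mppRelations p L A, 2 ≤ R.1 → Rectangular R.2

/-- For the binary operation `f`, the map `x ↦ f (a, x)` is a permutation of order `n`. -/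
def IsPermOfOrder {A : Type w} (f : (Fin 2 → A) → A) (a : A) (n : ℕ) : Prop :=
  ∃ σ : Equiv.Perm A, (∀ x, σ x = f ![a, x]) ∧ orderOf σ = n

/-- `f` is a `p`-automorphic polynomial of the structure. -/
def IsPAutomorphicPolynomial (p : ℕ) (L : FirstOrder.Language.{u, v}) {A : Type w} [L.Structure A]
    (f : (Fin 2 → A) → A) : Prop :=
  IsPolymorphism f (basicRelations L A) ∧
    (∀ a : A, (∀ x, f ![a, x] = x) ∨ IsPermOfOrder f a p) ∧
    ∃ a : A, IsPermOfOrder f a p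

/-! ### The ternary indicator problem and indicator rectangularity obstructions -/

/-- The indicator predicate `Υ₃`: the set of solutions of the ternary indicator problem of `Γ`.
The variables are the triples over `A`, and for each `R ∈ Γ` there is a constraint `R` on the
sequence of triples `z₁, …, zₙ` whenever `(z₁[t], …, zₙ[t]) ∈ R` for `t = 1, 2, 3`. -/
def indicator {A : Type w} (Γ : Set (FinRel A)) : Set ((Fin 3 → A) → A) :=
  {φ | ∀ R ∈ Γ, ∀ z : Fin R.1 → Fin 3 → A,
    (∀ t : Fin 3, (fun q => z q t) ∈ R.2) → (fun q => φ (z q)) ∈ R.2}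

/-- The ternary polymorphisms of the structure that are not polymorphisms of `⟨H⟩_p`. -/
abbrev ExtraPol (p : ℕ) (L : FirstOrder.Language.{u, v}) (A : Type w) [L.Structure A] : Type w :=
  {f : (Fin 3 → A) → A //
    IsPolymorphism f (basicRelations L A) ∧ ¬ IsPolymorphism f (mppRelations p L A)}

theorem exists_not_preserved {p : ℕ} {L : FirstOrder.Language.{u, v}} {A : Type w} [L.Structure A]
    (f : ExtraPol p L A) :
    ∃ Q : FinRel A, Q ∈ mppRelations p L A ∧ ¬ IsPolymorphism f.1 {Q} := by
  by_contra! h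
  exact f.2.2 fun R hR => h R hR R rfl

/-- A chosen relation `Q_f ∈ ⟨H⟩_p` that is not preserved by `f`. -/
noncomputable def separatingRel {p : ℕ} {L : FirstOrder.Language.{u, v}} {A : Type w} [L.Structure A]
    (f : ExtraPol p L A) : FinRel A :=
  (exists_not_preserved f).choose

/-- The relations of the expansion `H^{†p}` of the structure by all the relations `Q_f`. -/
def daggerRelations (p : ℕ) (L : FirstOrder.Language.{u, v}) (A : Type w) [L.Structure A] :
    Set (FinRel A) :=
  basicRelations L A ∪ Set.range (separatingRel : ExtraPol p L A → FinRel A)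

/-- The coordinates `(a, b, b)`. -/
def coordI (A : Type w) : Set (Fin 3 → A) := {z | ∃ a b : A, z = ![a, b, b]}

/-- The coordinates `(b, b, a)` with `a ≠ b`. -/
def coordJ (A : Type w) : Set (Fin 3 → A) := {z | ∃ a b : A, a ≠ b ∧ z = ![b, b, a]}

/-- The coordinates in the union of the two sets above. -/
abbrev CoordIJ (A : Type w) : Type w := {z : Fin 3 → A // z ∈ coordI A ∪ coordJ A}

/-- The tuple with entry `a` at `(a, b, b)`. -/
def tupleA (A : Type w) : coordI A → A := fun z => z.1 0

/-- The tuple with entry `b` at `(a, b, b)`. -/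
def tupleB (A : Type w) : coordI A → A := fun z => z.1 1

/-- The tuple with entry `c` at `(c, c, d)`. -/
def tupleC (A : Type w) : coordJ A → A := fun z => z.1 0

/-- The tuple with entry `d` at `(c, c, d)`. -/
def tupleD (A : Type w) : coordJ A → A := fun z => z.1 2

open Classical in
/-- The tuple `(s, t)` formed by a tuple `s` on the first and a tuple `t` on the second set of
coordinates. -/
noncomputable def joinIJ {A : Type w} (s : coordI A → A) (t : coordJ A → A) : CoordIJ A → A :=
  fun z => if h : z.1 ∈ coordI A then s ⟨z.1, h⟩ else t ⟨z.1, z.2.resolve_left h⟩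

/-- `R` is a `p`-indicator rectangularity obstruction. -/
def IsIndicatorObstruction (p : ℕ) (L : FirstOrder.Language.{u, v}) {A : Type w} [L.Structure A]
    (R : Set (CoordIJ A → A)) : Prop :=
  R ⊆ (fun (φ : (Fin 3 → A) → A) (z : CoordIJ A) => φ z.1) '' indicator (daggerRelations p L A) ∧
    joinIJ (tupleA A) (tupleC A) ∈ R ∧
    joinIJ (tupleB A) (tupleC A) ∈ R ∧
    joinIJ (tupleB A) (tupleD A) ∈ R ∧
    joinIJ (tupleA A) (tupleD A) ∉ R

/-- The structure admits a `p`-indicator rectangularity obstruction. -/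
def AdmitsIndicatorObstruction (p : ℕ) (L : FirstOrder.Language.{u, v}) (A : Type w) [L.Structure A] :
    Prop :=
  ∃ R : Set (CoordIJ A → A), IsIndicatorObstruction p L R ∧ MppDefinable p L R

end ModCSP

/-! Let P (`ternaryPol`) be the set of ternary polymorphisms of all p-mpp-definable relations, read
as a relation with coordinates indexed by A^3. It is definable, being an intersection of definable
relations, and it is the least definable relation containing the three projections
(`ternaryPol_subset`). On I ∪ J the projections restrict to (a,c), (b,c), (b,d), while a member of P
restricting to (a,d) is a Mal'tsev operation. Hence, if there is no Mal'tsev polymorphism, the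
restriction of P to I ∪ J is an obstruction, provided that it is definable.

Definability is the difficulty: coordinates outside I ∪ J can be removed only by counting extensions
modulo p. The key is `mppDefinable_cylinder_of_subset`. The relation given by a nonzero count always
lies inside the wanted projection of P; by minimality of P it is all of it as soon as it contains
the three projections. So only three counts matter, and equalities between coordinates may be
imposed first to correct them.

To remove one coordinate z, let V_i be the set of values at z of members of P that agree with the
i-th projection on the remaining coordinates. If some remaining coordinate t has t_i ∈ V_i for all
i, equating z with t leaves one extension in each case. If V_1 is disjoint from V_0 and from V_2,
each V_i has one or two elements, which settles odd p.

For p = 2, the triples that are not of the form (x,y,x) go in the same way, because there the V_i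
become singletons. What is left is a problem about binary operations φ(x,y,x), abstracted in
`ElimSystem`. Over three elements, the coordinates (c,a) and (c,b) are removed together
(`G_or_swap`), and this fails only when some operation swaps a and b for the parameter c. That
operation is trivial for all other parameters and {a,b} is then a 2-subalgebra, which is the third
alternative. -/

namespace ModCSP

/-! ### Closure properties of modular primitive positive definability -/

section Closure

variable {L : FirstOrder.Language.{u, v}} {A : Type w} [L.Structure A] {ι κ τ : Type*} {p : ℕ}

/-- Renaming of the variables of an atomic formula. -/
def Atom.map {V W : Type*} (ρ : V → W) : Atom L V → Atom L W
  | .eq x y => .eq (ρ x) (ρ y)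
  | .rel R x => .rel R (fun i => ρ (x i))

theorem Atom.holds_map {V W : Type*} (ρ : V → W) (φ : W → A) (α : Atom L V) :
    (α.map ρ).Holds φ ↔ α.Holds (fun x => φ (ρ x)) := by
  cases α <;> rfl

variable (L) in
/-- `N` counts the extensions to a solution of some conjunction of atomic formulas. -/
def IsCount (N : (ι → A) → ℕ) : Prop :=
  ∃ (s : ℕ) (Φ : List (Atom L (ι ⊕ Fin s))), ∀ a, N a = numExt Φ a

theorem isCount_of_finite {σ : Type*} [Finite σ] (Φ : List (Atom L (ι ⊕ σ))) :
    IsCount L fun a : ι → A => Nat.card {b : σ → A // ∀ α ∈ Φ, α.Holds (Sum.elim a b)} := by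
  obtain ⟨n, ⟨e⟩⟩ := Finite.exists_equiv_fin σ
  refine ⟨n, Φ.map (Atom.map (Sum.map id e)), fun a => ?_⟩
  refine Nat.card_congr ((e.arrowCongr (Equiv.refl A)).subtypeEquiv fun b => ?_)
  simp only [List.forall_mem_map, Atom.holds_map]
  refine forall₂_congr fun α _ => ?_
  have : (fun x => Sum.elim a ((e.arrowCongr (Equiv.refl A)) b) (Sum.map id e x)) =
      Sum.elim a b := by
    funext x
    rcases x with x | x <;> simp
  rw [this]

theorem IsCount.one : IsCount L fun _ : ι → A => 1 :=
  ⟨0, [], fun a => by simp [numExt]⟩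

open Classical in
theorem isCount_atom (α : Atom L ι) : IsCount L fun a : ι → A => if α.Holds a then 1 else 0 := by
  refine ⟨0, [α.map Sum.inl], fun a => ?_⟩
  by_cases h : α.Holds a <;> simp [numExt, Atom.holds_map, h]

theorem IsCount.comp {N : (ι → A) → ℕ} (hN : IsCount L N) (ρ : ι → κ) :
    IsCount L fun a : κ → A => N fun i => a (ρ i) := by
  obtain ⟨s, Φ, h⟩ := hN
  refine ⟨s, Φ.map (Atom.map (Sum.map ρ id)), fun a => ?_⟩
  refine (h _).trans ?_
  refine Nat.card_congr (Equiv.subtypeEquivRight fun b => ?_)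
  simp only [List.forall_mem_map, Atom.holds_map]
  refine forall₂_congr fun α _ => ?_
  have : (fun x => Sum.elim a b (Sum.map ρ id x)) = Sum.elim (fun i => a (ρ i)) b := by
    funext x
    rcases x with x | x <;> simp
  rw [this]

theorem IsCount.mul {N M : (ι → A) → ℕ} (hN : IsCount L N) (hM : IsCount L M) :
    IsCount L fun a => N a * M a := by
  obtain ⟨s, Φ, h⟩ := hN
  obtain ⟨t, Ψ, k⟩ := hM
  convert isCount_of_finite (A := A) (Φ.map (Atom.map (Sum.map id (Sum.inl : _ → Fin s ⊕ Fin t))) ++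
    Ψ.map (Atom.map (Sum.map id (Sum.inr : _ → Fin s ⊕ Fin t)))) using 2 with a
  rw [h, k, numExt, numExt, ← Nat.card_prod]
  refine Nat.card_congr (Equiv.subtypeProdEquivProd.symm.trans
    ((Equiv.sumArrowEquivProdArrow _ _ _).symm.subtypeEquiv fun b => ?_))
  simp only [List.forall_mem_append, List.forall_mem_map, Atom.holds_map]
  have h1 : (fun x => Sum.elim a ((Equiv.sumArrowEquivProdArrow _ _ _).symm b)
      (Sum.map id (Sum.inl : _ → Fin s ⊕ Fin t) x)) = Sum.elim a b.1 := by
    funext x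
    rcases x with x | x <;> rfl
  have h2 : (fun x => Sum.elim a ((Equiv.sumArrowEquivProdArrow _ _ _).symm b)
      (Sum.map id (Sum.inr : _ → Fin s ⊕ Fin t) x)) = Sum.elim a b.2 := by
    funext x
    rcases x with x | x <;> rfl
  rw [h1, h2]

theorem IsCount.pow {N : (ι → A) → ℕ} (hN : IsCount L N) (k : ℕ) :
    IsCount L fun a => N a ^ k := by
  induction k with
  | zero => simpa using IsCount.one
  | succ k ih => simpa only [pow_succ] using ih.mul hN

theorem IsCount.sum [Finite A] [Finite τ] [Fintype (τ → A)] {N : (ι ⊕ τ → A) → ℕ}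
    (hN : IsCount L N) : IsCount L fun a : ι → A => ∑ b : τ → A, N (Sum.elim a b) := by
  obtain ⟨s, Φ, h⟩ := hN
  convert isCount_of_finite (A := A) (Φ.map (Atom.map (Equiv.sumAssoc ι τ (Fin s)))) using 2 with a
  simp only [h, numExt]
  rw [← Nat.card_sigma]
  refine Nat.card_congr ?_
  have key : ∀ (b : τ → A) (c : Fin s → A),
      (∀ α ∈ Φ, α.Holds (Sum.elim (Sum.elim a b) c)) ↔
      ∀ α ∈ Φ.map (Atom.map (Equiv.sumAssoc ι τ (Fin s))), α.Holds (Sum.elim a (Sum.elim b c)) := by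
    intro b c
    simp only [List.forall_mem_map, Atom.holds_map]
    refine forall₂_congr fun α _ => ?_
    have : (fun x => Sum.elim a (Sum.elim b c) (Equiv.sumAssoc ι τ (Fin s) x)) =
        Sum.elim (Sum.elim a b) c := by
      funext x
      rcases x with (x | x) | x <;> rfl
    rw [this]
  exact
    { toFun := fun x => ⟨Sum.elim x.1 x.2.1, (key _ _).1 x.2.2⟩
      invFun := fun y => ⟨fun i => y.1 (.inl i), fun i => y.1 (.inr i),
        (key _ _).2 (by
          have : (Sum.elim (fun i => y.1 (.inl i)) fun i => y.1 (.inr i)) = y.1 := by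
            funext i
            rcases i with i | i <;> rfl
          rw [this]
          exact y.2)⟩
      left_inv := fun x => rfl
      right_inv := fun y => by
        ext i
        rcases i with i | i <;> rfl }

theorem mppDefinable_iff_isCount {R : Set (ι → A)} :
    MppDefinable p L R ↔ ∃ N, IsCount L N ∧ ∀ a, a ∈ R ↔ ¬ p ∣ N a := by
  simp only [MppDefinable, Nat.modEq_zero_iff_dvd]
  constructor
  · rintro ⟨s, Φ, h⟩
    exact ⟨_, ⟨s, Φ, fun _ => rfl⟩, h⟩
  · rintro ⟨N, ⟨s, Φ, hN⟩, h⟩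
    exact ⟨s, Φ, fun a => by rw [h, hN]⟩

/-- By Fermat's little theorem the (p-1)-st power of a count is 0 or 1 modulo p. Normalised in this
way, counts can be summed over further variables to count the tuples of R themselves. -/
theorem MppDefinable.exists_indicator [hp : Fact p.Prime] {R : Set (ι → A)}
    (hR : MppDefinable p L R) :
    ∃ N, IsCount L N ∧ ∀ a, (N a : ZMod p) = R.indicator 1 a := by
  obtain ⟨N, hN, h⟩ := mppDefinable_iff_isCount.1 hR
  refine ⟨_, hN.pow (p - 1), fun a => ?_⟩
  push_cast
  by_cases ha : a ∈ R
  · rw [Set.indicator_of_mem ha, Pi.one_apply]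
    refine ZMod.pow_card_sub_one_eq_one fun h0 => (h a).1 ha ?_
    exact (ZMod.natCast_eq_zero_iff _ _).1 h0
  · have : p ∣ N a := by simpa [h] using ha
    rw [Set.indicator_of_notMem ha, (ZMod.natCast_eq_zero_iff _ _).2 this]
    exact zero_pow (by have := hp.out.two_le; omega)

theorem MppDefinable.comp {R : Set (ι → A)} (hR : MppDefinable p L R) (ρ : ι → κ) :
    MppDefinable p L {a : κ → A | (fun i => a (ρ i)) ∈ R} := by
  obtain ⟨N, hN, h⟩ := mppDefinable_iff_isCount.1 hR
  exact mppDefinable_iff_isCount.2 ⟨_, hN.comp ρ, fun a => h _⟩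

theorem mppDefinable_univ (hp : p.Prime) : MppDefinable p L (Set.univ : Set (ι → A)) :=
  mppDefinable_iff_isCount.2 ⟨_, IsCount.one, fun a => by simpa using hp.one_lt.ne'⟩

theorem mppDefinable_atom (hp : p.Prime) (α : Atom L ι) :
    MppDefinable p L {a : ι → A | α.Holds a} := by
  refine mppDefinable_iff_isCount.2 ⟨_, isCount_atom α, fun a => ?_⟩
  by_cases h : α.Holds a <;> simp [h, hp.one_lt.ne']

theorem MppDefinable.inter (hp : p.Prime) {R S : Set (ι → A)} (hR : MppDefinable p L R)
    (hS : MppDefinable p L S) : MppDefinable p L (R ∩ S) := by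
  obtain ⟨N, hN, h⟩ := mppDefinable_iff_isCount.1 hR
  obtain ⟨M, hM, k⟩ := mppDefinable_iff_isCount.1 hS
  refine mppDefinable_iff_isCount.2 ⟨_, hN.mul hM, fun a => ?_⟩
  rw [Set.mem_inter_iff, h, k, hp.dvd_mul, not_or]

/-- Arbitrary families are allowed because there are only finitely many relations on a finite index
set. -/
theorem mppDefinable_sInter [Finite A] [Finite ι] (hp : p.Prime) (F : Set (Set (ι → A)))
    (hF : ∀ R ∈ F, MppDefinable p L R) : MppDefinable p L (⋂₀ F) := by
  induction F, F.toFinite using Set.Finite.induction_on with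
  | empty => simpa using mppDefinable_univ hp
  | insert _ _ ih =>
    rw [Set.sInter_insert]
    exact (hF _ (Set.mem_insert _ _)).inter hp (ih fun R hR => hF R (Set.mem_insert_of_mem _ hR))

theorem mppDefinable_iInter [Finite A] [Finite ι] (hp : p.Prime) {κ : Sort*} (F : κ → Set (ι → A))
    (hF : ∀ k, MppDefinable p L (F k)) : MppDefinable p L (⋂ k, F k) :=
  mppDefinable_sInter hp _ (by rintro _ ⟨k, rfl⟩; exact hF k)

theorem mppDefinable_const (hp : p.Prime) (hc : HasConstants L A) (i : ι) (x : A) :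
    MppDefinable p L {a : ι → A | a i = x} := by
  obtain ⟨C, hC⟩ := hc x
  convert mppDefinable_atom hp (Atom.rel C fun _ => i) using 3 with a
  exact (hC fun _ => a i).symm

/-- Definable relations are closed under modular quantification. -/
theorem MppDefinable.not_dvd_card [Finite A] [Finite τ] (hp : p.Prime) {R : Set (ι ⊕ τ → A)}
    (hR : MppDefinable p L R) :
    MppDefinable p L {a : ι → A | ¬ p ∣ Nat.card {b : τ → A // Sum.elim a b ∈ R}} := by
  classical
  have := Fact.mk hp
  have := Fintype.ofFinite A
  have := Fintype.ofFinite τ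
  obtain ⟨N, hN, h⟩ := hR.exists_indicator
  refine mppDefinable_iff_isCount.2 ⟨_, hN.sum, fun a => ?_⟩
  rw [Set.mem_ofPred_eq, ← ZMod.natCast_eq_zero_iff, ← ZMod.natCast_eq_zero_iff, Nat.cast_sum]
  simp only [h, Set.indicator_apply, Pi.one_apply]
  rw [Finset.sum_boole, Nat.card_eq_fintype_card, Fintype.card_subtype]

theorem basicRelations_subset_mppRelations (hp : p.Prime) :
    basicRelations L A ⊆ mppRelations p L A := by
  rintro R ⟨S, hS⟩
  have := mppDefinable_atom (A := A) hp (Atom.rel S id)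
  rw [mppRelations, Set.mem_ofPred_eq, hS]
  exact this

end Closure

/-! ### Ternary polymorphisms of the definable relations and their projections -/

section Ternary

variable {p : ℕ} {L : FirstOrder.Language.{u, v}} {A : Type w} [L.Structure A]

variable (p L A) in
/-- The ternary polymorphisms of all `p`-mpp-definable relations. -/
def ternaryPol : Set ((Fin 3 → A) → A) := {φ | IsPolymorphism φ (mppRelations p L A)}

/-- The ternary projections. -/
def proj (i : Fin 3) : (Fin 3 → A) → A := fun z => z i

theorem proj_mem_ternaryPol (i : Fin 3) : proj i ∈ ternaryPol p L A :=
  fun _ _ _ ht => ht i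

theorem ternaryPol_apply_mem {ι : Type*} [Finite ι] {R : Set (ι → A)} (hR : MppDefinable p L R)
    {φ : (Fin 3 → A) → A} (hφ : φ ∈ ternaryPol p L A) (x : Fin 3 → ι → A) (hx : ∀ j, x j ∈ R) :
    (fun i => φ fun j => x j i) ∈ R := by
  obtain ⟨n, ⟨e⟩⟩ := Finite.exists_equiv_fin ι
  have h := hφ ⟨n, {y | (fun i => y (e i)) ∈ R}⟩ (hR.comp e) (fun j k => x j (e.symm k))
    (fun j => by simpa using hx j)
  simpa using h

theorem mppDefinable_ternaryPol [Finite A] (hp : p.Prime) :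
    MppDefinable p L (ternaryPol p L A) := by
  have : ternaryPol p L A = ⋂ (R : FinRel A) (_ : R ∈ mppRelations p L A)
      (t : Fin 3 → Fin R.1 → A) (_ : ∀ j, t j ∈ R.2), {φ | (fun i => φ fun j => t j i) ∈ R.2} := by
    ext φ
    simp only [Set.mem_iInter]
    rfl
  rw [this]
  exact mppDefinable_iInter hp _ fun R => mppDefinable_iInter hp _ fun hR =>
    mppDefinable_iInter hp _ fun t => mppDefinable_iInter hp _ fun _ =>
      MppDefinable.comp (R := R.2) hR fun i j => t j i

/-- The set of these polymorphisms is itself a definable relation, so it is preserved by its own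
members. -/
theorem ternaryPol_comp_mem [Finite A] (hp : p.Prime) {φ : (Fin 3 → A) → A}
    (hφ : φ ∈ ternaryPol p L A) (ψ : Fin 3 → (Fin 3 → A) → A)
    (hψ : ∀ j, ψ j ∈ ternaryPol p L A) : (fun z => φ fun j => ψ j z) ∈ ternaryPol p L A :=
  ternaryPol_apply_mem (mppDefinable_ternaryPol hp) hφ ψ hψ

/-- Applying φ to the three projections gives back φ. This minimality reduces every elimination to a
check on the projections. -/
theorem ternaryPol_subset [Finite A] {R : Set ((Fin 3 → A) → A)} (hR : MppDefinable p L R)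
    (h : ∀ i, proj i ∈ R) : ternaryPol p L A ⊆ R :=
  fun _ hφ => ternaryPol_apply_mem hR hφ proj h

theorem ternaryPol_subset_indicator (hp : p.Prime) :
    ternaryPol p L A ⊆ indicator (daggerRelations p L A) := by
  intro φ hφ R hR z hz
  refine hφ R ?_ (fun j i => z i j) hz
  rcases hR with hR | ⟨f, rfl⟩
  · exact basicRelations_subset_mppRelations hp hR
  · exact (exists_not_preserved f).choose_spec.1

variable (p L) in
/-- The maps that agree on `W` with some ternary polymorphism of the definable relations. -/
def cylinder (W : Set (Fin 3 → A)) : Set ((Fin 3 → A) → A) :=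
  {φ | ∃ ψ ∈ ternaryPol p L A, Set.EqOn ψ φ W}

variable (p L) in
/-- The ternary polymorphisms that agree on `W` with the `i`-th projection. -/
def polFixing (i : Fin 3) (W : Set (Fin 3 → A)) : Set ((Fin 3 → A) → A) :=
  {φ | φ ∈ ternaryPol p L A ∧ Set.EqOn φ (proj i) W}

theorem proj_mem_polFixing (i : Fin 3) (W : Set (Fin 3 → A)) : proj i ∈ polFixing p L i W :=
  ⟨proj_mem_ternaryPol i, fun _ _ => rfl⟩

theorem mppDefinable_cylinder_univ [Finite A] (hp : p.Prime) :
    MppDefinable p L (cylinder p L (Set.univ : Set (Fin 3 → A))) := by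
  convert mppDefinable_ternaryPol (L := L) (A := A) hp
  ext φ
  constructor
  · rintro ⟨ψ, hψ, h⟩
    rwa [(Set.eqOn_univ _ _).1 h] at hψ
  · exact fun h => ⟨φ, h, fun _ _ => rfl⟩

/-- The coordinates in `W' \ W` can be eliminated from the projection of the ternary polymorphisms
to `W'` if, after imposing the equalities of coordinates given by `E`, the numbers of extensions
of the three projections are not divisible by `p`. -/
theorem mppDefinable_cylinder_of_subset [Finite A] (hp : p.Prime) {W W' : Set (Fin 3 → A)}
    (hW : W ⊆ W') (hG : MppDefinable p L (cylinder p L W')) (E : (Fin 3 → A) → Fin 3 → A)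
    (hE : ∀ z ∈ W', E z ∈ W')
    (h : ∀ i, ¬ p ∣ (W'.domRestrict ''
      {φ | φ ∈ polFixing p L i W ∧ ∀ z ∈ W', φ (E z) = φ z}).ncard) :
    MppDefinable p L (cylinder p L W) := by
  classical
  let S : Set ((Fin 3 → A) → A) := {φ | φ ∈ cylinder p L W' ∧ ∀ z ∈ W', φ (E z) = φ z}
  have hS : MppDefinable p L S := by
    have : S = cylinder p L W' ∩ ⋂ (z : Fin 3 → A) (_ : z ∈ W'), {φ | φ (E z) = φ z} := by
      ext φ
      simp only [Set.mem_inter_iff, Set.mem_iInter]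
      rfl
    rw [this]
    exact hG.inter hp (mppDefinable_iInter hp _ fun z => mppDefinable_iInter hp _ fun _ =>
      mppDefinable_atom hp (Atom.eq (E z) z))
  have hScongr : ∀ {η η' : (Fin 3 → A) → A}, Set.EqOn η η' W' → η ∈ S → η' ∈ S := by
    rintro η η' hη ⟨⟨ψ, hψ, h1⟩, h2⟩
    exact ⟨⟨ψ, hψ, h1.trans hη⟩, fun z hz => by rw [← hη (hE z hz), ← hη hz, h2 z hz]⟩
  -- Overwrite φ on the coordinates to be eliminated.
  let ov (φ : (Fin 3 → A) → A) (θ : ↥(W' \ W) → A) : (Fin 3 → A) → A :=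
    fun z => if h : z ∈ W' \ W then θ ⟨z, h⟩ else φ z
  have ov_mem : ∀ φ θ z (hz : z ∈ W' \ W), ov φ θ z = θ ⟨z, hz⟩ := fun φ θ z hz => dif_pos hz
  have ov_W : ∀ φ θ, Set.EqOn (ov φ θ) φ W := fun φ θ z hz => dif_neg fun h => h.2 hz
  let R : Set ((Fin 3 → A) → A) := {φ | ¬ p ∣ Nat.card {θ // ov φ θ ∈ S}}
  have hR : MppDefinable p L R := by
    have := (hS.comp (fun z => if h : z ∈ W' \ W then Sum.inr (⟨z, h⟩ : ↥(W' \ W)) else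
      Sum.inl z)).not_dvd_card hp
    have h1 : ∀ φ θ, (fun z => Sum.elim φ θ (if h : z ∈ W' \ W then Sum.inr (⟨z, h⟩ : ↥(W' \ W))
        else Sum.inl z)) = ov φ θ := by
      intro φ θ
      funext z
      simp only [ov]
      split_ifs <;> rfl
    simpa only [Set.mem_ofPred_eq, h1] using this
  -- The valid overwritings of a projection correspond to the restrictions to `W'` counted in the
  -- hypothesis `h`.
  have hproj : ∀ i, proj i ∈ R := by
    intro i
    change ¬ p ∣ Nat.card {θ | ov (proj i) θ ∈ S}
    rw [Nat.card_coe_set_eq, ← Set.ncard_image_of_injective (f := fun θ => W'.domRestrict (ov (proj i) θ))]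
    · convert h i using 3
      ext g
      constructor
      · rintro ⟨θ, ⟨⟨ψ, hψ, h1⟩, h2⟩, rfl⟩
        refine ⟨ψ, ⟨⟨hψ, (h1.mono hW).trans (ov_W _ _)⟩, fun z hz => ?_⟩, ?_⟩
        · rw [h1 (hE z hz), h1 hz, h2 z hz]
        · funext z
          exact h1 z.2
      · rintro ⟨φ, ⟨⟨hφ, h1⟩, h2⟩, rfl⟩
        have key : Set.EqOn φ (ov (proj i) fun z => φ z.1) W' := by
          intro z hz
          by_cases hzW : z ∈ W
          · exact (h1 hzW).trans (ov_W (proj i) (fun z => φ z.1) hzW).symm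
          · exact (ov_mem (proj i) (fun z => φ z.1) z ⟨hz, hzW⟩).symm
        refine ⟨fun z => φ z.1, hScongr key ⟨⟨φ, hφ, fun _ _ => rfl⟩, h2⟩, ?_⟩
        funext z
        exact (key z.2).symm
    · intro θ θ' hθ
      funext z
      have := congrFun hθ ⟨z, z.2.1⟩
      simpa only [Set.domRestrict_apply, ov_mem _ _ z.1 z.2] using this
  convert hR
  ext φ
  constructor
  · rintro ⟨ψ, hψ, h1⟩
    -- Minimality puts `ψ` into `R`; membership in `R` depends only on the values on `W`, so `φ`
    -- follows.
    have h2 := ternaryPol_subset hR hproj hψ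
    have : ∀ θ, Set.EqOn (ov ψ θ) (ov φ θ) W' := by
      intro θ z hz
      by_cases hzW : z ∈ W
      · rw [ov_W _ _ hzW, ov_W _ _ hzW, h1 hzW]
      · rw [ov_mem _ _ z ⟨hz, hzW⟩, ov_mem _ _ z ⟨hz, hzW⟩]
    have : ∀ θ, ov ψ θ ∈ S ↔ ov φ θ ∈ S := fun θ => ⟨hScongr (this θ), hScongr (this θ).symm⟩
    simpa only [R, Set.mem_ofPred_eq, this] using h2
  · intro hφ
    have : Nat.card {θ // ov φ θ ∈ S} ≠ 0 := fun h0 => hφ (h0 ▸ dvd_zero p)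
    obtain ⟨⟨θ, ⟨ψ, hψ, h1⟩, -⟩⟩ := (Nat.card_ne_zero.1 this).1
    exact ⟨ψ, hψ, (h1.mono hW).trans (ov_W _ _)⟩

theorem ncard_domRestrict_image_eq_one {Z B : Type*} {W : Set Z} {S : Set (Z → B)} {φ : Z → B}
    (hφ : φ ∈ S) (h : ∀ ψ ∈ S, Set.EqOn ψ φ W) : (W.domRestrict '' S).ncard = 1 := by
  rw [Set.ncard_eq_one]
  refine ⟨W.domRestrict φ, Set.eq_singleton_iff_unique_mem.2 ⟨⟨φ, hφ, rfl⟩, ?_⟩⟩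
  rintro _ ⟨ψ, hψ, rfl⟩
  exact Set.domRestrict_eq_domRestrict_iff.2 (h ψ hψ)

/-- Imposing that the values at z and t coincide makes the extension of each projection unique: its
value at z must be `t i`, and by hypothesis this value occurs. -/
theorem mppDefinable_cylinder_of_mem [Finite A] (hp : p.Prime) {W : Set (Fin 3 → A)}
    {z t : Fin 3 → A} (hG : MppDefinable p L (cylinder p L (insert z W))) (ht : t ∈ W)
    (h : ∀ i, ∃ φ ∈ polFixing p L i W, φ z = t i) : MppDefinable p L (cylinder p L W) := by
  classical
  by_cases hz : z ∈ W
  · rwa [Set.insert_eq_of_mem hz] at hG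
  refine mppDefinable_cylinder_of_subset hp (Set.subset_insert _ _) hG (Function.update id z t)
    ?_ fun i => ?_
  · intro y hy
    by_cases hyz : y = z
    · subst hyz
      simpa using Or.inr ht
    · simpa [hyz] using hy
  · obtain ⟨φ, hφ, hφz⟩ := h i
    have key : ∀ ψ ∈ polFixing p L i W, ψ z = t i → ∀ y ∈ insert z W,
        ψ (Function.update id z t y) = ψ y := by
      rintro ψ hψ hψz y (rfl | hy)
      · rw [Function.update_self, hψz, hψ.2 ht]
        rfl
      · rw [Function.update_of_ne (by rintro rfl; exact hz hy), id]
    rw [ncard_domRestrict_image_eq_one (φ := φ)]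
    · exact fun h1 => hp.one_lt.ne' (Nat.dvd_one.1 h1)
    · exact ⟨hφ, key φ hφ hφz⟩
    · rintro ψ ⟨hψ, hψE⟩ y (rfl | hy)
      · have := hψE y (Set.mem_insert _ _)
        rw [Function.update_self] at this
        rw [← this, hφz, hψ.2 ht]
        rfl
      · rw [hψ.2 hy, hφ.2 hy]

/-- No equality is imposed here; an extension is determined by its value at the single new
coordinate. -/
theorem mppDefinable_cylinder_of_ncard [Finite A] (hp : p.Prime) {W : Set (Fin 3 → A)}
    {z : Fin 3 → A} (hG : MppDefinable p L (cylinder p L (insert z W)))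
    (h : ∀ i, ¬ p ∣ ((fun φ => φ z) '' polFixing p L i W).ncard) :
    MppDefinable p L (cylinder p L W) := by
  refine mppDefinable_cylinder_of_subset hp (Set.subset_insert z _) hG id (fun _ h => h) fun i => ?_
  have h1 : {φ | φ ∈ polFixing p L i W ∧ ∀ y ∈ insert z W, φ (id y) = φ y} = polFixing p L i W := by
    ext φ
    exact and_iff_left fun _ _ => rfl
  have h2 : (fun φ : (Fin 3 → A) → A => φ z) '' polFixing p L i W =
      (fun g => g ⟨z, Set.mem_insert _ _⟩) '' ((insert z W).domRestrict '' polFixing p L i W) := by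
    rw [Set.image_image]
    rfl
  have h3 := h i
  rw [h2, Set.InjOn.ncard_image] at h3
  · rwa [h1]
  · rintro _ ⟨φ, hφ, rfl⟩ _ ⟨ψ, hψ, rfl⟩ hz
    refine Set.domRestrict_eq_domRestrict_iff.2 ?_
    rintro y (rfl | hy)
    · exact hz
    · rw [hφ.2 hy, hψ.2 hy]

theorem mppDefinable_cylinder_of_forall [Finite A] {W : Set (Fin 3 → A)}
    (h : ∀ W', W ⊆ W' → ∀ z, MppDefinable p L (cylinder p L (insert z W')) →
      MppDefinable p L (cylinder p L W'))
    (hG : MppDefinable p L (cylinder p L (Set.univ : Set (Fin 3 → A)))) :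
    MppDefinable p L (cylinder p L W) := by
  suffices ∀ T : Set (Fin 3 → A), MppDefinable p L (cylinder p L (W ∪ T)) →
      MppDefinable p L (cylinder p L W) from this Set.univ (by rwa [Set.union_univ])
  intro T
  induction T, T.toFinite using Set.Finite.induction_on with
  | empty => simp
  | insert _ _ ih =>
    intro hT
    rw [Set.union_insert] at hT
    exact ih (h _ Set.subset_union_left _ hT)

/-- When the value at z determines the rest of the operation on `W'`, each attained value has
exactly one witness, so counting modulo p agrees with existence. -/
theorem isPSubalgebra_of_polFixing [Finite A] (hp : p.Prime) (hc : HasConstants L A)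
    {W W' : Set (Fin 3 → A)} (hG : MppDefinable p L (cylinder p L W')) (hW : W ⊆ W') (i : Fin 3)
    {z : Fin 3 → A} (hz : z ∈ W')
    (h : ∀ φ ∈ polFixing p L i W, ∀ ψ ∈ polFixing p L i W, φ z = ψ z → Set.EqOn φ ψ W') :
    IsPSubalgebra p L ((fun φ => φ z) '' polFixing p L i W) := by
  classical
  -- Constants fix the values on `W`. They also freeze the irrelevant coordinates outside `W'`,
  -- which would otherwise multiply the count.
  let S : Set ((Fin 3 → A) → A) :=
    {θ | θ ∈ cylinder p L W' ∧ ∀ t, t ∈ W ∨ t ∉ W' → θ t = t i}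
  have hS : MppDefinable p L S := by
    have : S = cylinder p L W' ∩ ⋂ (t : Fin 3 → A) (_ : t ∈ W ∨ t ∉ W'), {θ | θ t = t i} := by
      ext φ
      simp only [Set.mem_inter_iff, Set.mem_iInter]
      rfl
    rw [this]
    exact hG.inter hp (mppDefinable_iInter hp _ fun z => mppDefinable_iInter hp _ fun _ =>
      mppDefinable_const hp hc _ _)
  have hR := ((hS.comp (Sum.inr : _ → Fin 1 ⊕ (Fin 3 → A))).inter hp
    (mppDefinable_atom (A := A) hp (Atom.eq (Sum.inl 0) (Sum.inr z)))).not_dvd_card hp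
  rw [IsPSubalgebra]
  convert hR using 1
  ext x
  change (∃ φ ∈ polFixing p L i W, φ z = x 0) ↔ ¬ p ∣ Nat.card {θ // θ ∈ S ∧ x 0 = θ z}
  have toPol : ∀ θ ∈ S, ∃ φ ∈ polFixing p L i W, Set.EqOn φ θ W' := by
    rintro θ ⟨⟨φ, hφ, h1⟩, h2⟩
    exact ⟨φ, ⟨hφ, fun t ht => by rw [h1 (hW ht), h2 t (Or.inl ht)]; rfl⟩, h1⟩
  constructor
  · rintro ⟨φ, hφ, hx⟩
    have h1 : Nat.card {θ // θ ∈ S ∧ x 0 = θ z} = 1 := by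
      rw [Nat.card_eq_one_iff_unique]
      refine ⟨⟨?_⟩, ⟨⟨fun t => if t ∈ W' then φ t else t i, ⟨⟨φ, hφ.1, fun t ht => ?_⟩, ?_⟩, ?_⟩⟩⟩
      · rintro ⟨θ, hθ, h1⟩ ⟨θ', hθ', h1'⟩
        obtain ⟨ψ, hψ, h2⟩ := toPol θ hθ
        obtain ⟨ψ', hψ', h2'⟩ := toPol θ' hθ'
        have := h ψ hψ ψ' hψ' (by rw [h2 hz, h2' hz, ← h1, ← h1'])
        ext t
        by_cases ht : t ∈ W'
        · change θ t = θ' t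
          rw [← h2 ht, ← h2' ht, this ht]
        · exact (hθ.2 t (Or.inr ht)).trans (hθ'.2 t (Or.inr ht)).symm
      · simp [ht]
      · rintro t (ht | ht)
        · simpa [hW ht, proj] using hφ.2 ht
        · simp [ht]
      · simp [hz, hx]
    rw [h1]
    exact fun h2 => hp.one_lt.ne' (Nat.dvd_one.1 h2)
  · intro hd
    have : Nat.card {θ // θ ∈ S ∧ x 0 = θ z} ≠ 0 := fun h0 => hd (by rw [h0]; exact dvd_zero p)
    obtain ⟨⟨θ, hθ, hx⟩⟩ := (Nat.card_ne_zero.1 this).1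
    obtain ⟨φ, hφ, h1⟩ := toPol θ hθ
    exact ⟨φ, hφ, by rw [h1 hz, hx]⟩

end Ternary

/-! ### Elimination of coordinates modulo 2 in a pair of families of binary operations -/

/-- Two families `LL` and `RR` of binary operations containing the first and the second projection,
respectively, together with the family `G` of sets of coordinates that are known to be
definable modulo 2, and the family `Sub` of subsets that are definable modulo 2. Pairs are elements
of `P`, with projections `p` and `q`, which makes the notion visibly self-dual. -/
structure ElimSystem (A P : Type*) where
  p : P → A
  q : P → A
  pair : A → A → P
  p_pair : ∀ x y, p (pair x y) = x
  q_pair : ∀ x y, q (pair x y) = y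
  pair_eta : ∀ z, pair (p z) (q z) = z
  LL : Set (P → A)
  RR : Set (P → A)
  p_mem : p ∈ LL
  q_mem : q ∈ RR
  idem_LL : ∀ l ∈ LL, ∀ x, l (pair x x) = x
  idem_RR : ∀ r ∈ RR, ∀ x, r (pair x x) = x
  comp_LL : ∀ f ∈ LL, ∀ l ∈ LL, ∀ r ∈ RR, (fun z => f (pair (l z) (r z))) ∈ LL
  comp_RR : ∀ f ∈ RR, ∀ l ∈ LL, ∀ r ∈ RR, (fun z => f (pair (l z) (r z))) ∈ RR
  closed_LL : ∀ f ∈ LL ∪ RR, ∀ l ∈ LL, ∀ l' ∈ LL, (fun z => f (pair (l z) (l' z))) ∈ LL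
  closed_RR : ∀ f ∈ LL ∪ RR, ∀ r ∈ RR, ∀ r' ∈ RR, (fun z => f (pair (r z) (r' z))) ∈ RR
  G : Set P → Prop
  Sub : Set A → Prop
  G_univ : G Set.univ
  -- Two parity conditions suffice: on triples (x,y,x) the families of the first and the third
  -- projection coincide.
  elim : ∀ (K K' : Set P) (E : P → P), (∀ x, pair x x ∈ K) → K ⊆ K' → G K' → (∀ z ∈ K', E z ∈ K') →
    Odd (K'.domRestrict '' {l | (l ∈ LL ∧ Set.EqOn l p K) ∧ ∀ z ∈ K', l (E z) = l z}).ncard →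
    Odd (K'.domRestrict '' {r | (r ∈ RR ∧ Set.EqOn r q K) ∧ ∀ z ∈ K', r (E z) = r z}).ncard → G K
  sub_LL : ∀ (K K' : Set P) (z : P), K ⊆ K' → G K' → z ∈ K' →
    (∀ l, l ∈ LL ∧ Set.EqOn l p K → ∀ l', l' ∈ LL ∧ Set.EqOn l' p K → l z = l' z →
      Set.EqOn l l' K') → Sub ((fun l => l z) '' {l | l ∈ LL ∧ Set.EqOn l p K})
  sub_RR : ∀ (K K' : Set P) (z : P), K ⊆ K' → G K' → z ∈ K' →
    (∀ r, r ∈ RR ∧ Set.EqOn r q K → ∀ r', r' ∈ RR ∧ Set.EqOn r' q K → r z = r' z →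
      Set.EqOn r r' K') → Sub ((fun r => r z) '' {r | r ∈ RR ∧ Set.EqOn r q K})

namespace ElimSystem

variable {A P : Type*}

/-- The system obtained by interchanging the two families and the two arguments. -/
def dual (S : ElimSystem A P) : ElimSystem A P where
  p := S.q
  q := S.p
  pair x y := S.pair y x
  p_pair x y := S.q_pair y x
  q_pair x y := S.p_pair y x
  pair_eta := S.pair_eta
  LL := S.RR
  RR := S.LL
  p_mem := S.q_mem
  q_mem := S.p_mem
  idem_LL := S.idem_RR
  idem_RR := S.idem_LL
  comp_LL f hf l hl r hr := S.comp_RR f hf r hr l hl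
  comp_RR f hf l hl r hr := S.comp_LL f hf r hr l hl
  closed_LL f hf l hl l' hl' := S.closed_RR f hf.symm l' hl' l hl
  closed_RR f hf l hl l' hl' := S.closed_LL f hf.symm l' hl' l hl
  G := S.G
  Sub := S.Sub
  G_univ := S.G_univ
  elim K K' E h1 h2 h3 h4 h5 h6 := S.elim K K' E h1 h2 h3 h4 h6 h5
  sub_LL := S.sub_RR
  sub_RR := S.sub_LL

variable (S : ElimSystem A P)

/-- The members of the first family that agree with the first projection on `K`. -/
def fixLL (K : Set P) : Set (P → A) := {l | l ∈ S.LL ∧ Set.EqOn l S.p K}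

/-- The members of the second family that agree with the second projection on `K`. -/
def fixRR (K : Set P) : Set (P → A) := {r | r ∈ S.RR ∧ Set.EqOn r S.q K}

variable {S} {K : Set P} {z : P}

theorem p_mem_fixLL : S.p ∈ S.fixLL K := ⟨S.p_mem, fun _ _ => rfl⟩

theorem q_mem_fixRR : S.q ∈ S.fixRR K := ⟨S.q_mem, fun _ _ => rfl⟩

theorem comp_mem_fixLL {f l r : P → A} (hf : f ∈ S.fixLL K) (hl : l ∈ S.fixLL K)
    (hr : r ∈ S.fixRR K) : (fun z => f (S.pair (l z) (r z))) ∈ S.fixLL K := by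
  refine ⟨S.comp_LL f hf.1 l hl.1 r hr.1, fun z hz => ?_⟩
  simp only [hl.2 hz, hr.2 hz, S.pair_eta, hf.2 hz]

theorem comp_mem_fixRR {f l r : P → A} (hf : f ∈ S.fixRR K) (hl : l ∈ S.fixLL K)
    (hr : r ∈ S.fixRR K) : (fun z => f (S.pair (l z) (r z))) ∈ S.fixRR K := by
  refine ⟨S.comp_RR f hf.1 l hl.1 r hr.1, fun z hz => ?_⟩
  simp only [hl.2 hz, hr.2 hz, S.pair_eta, hf.2 hz]

theorem odd_ncard_of_unique {K' : Set P} {F : Set (P → A)} {f : P → A} (hf : f ∈ F)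
    (h : ∀ g ∈ F, Set.EqOn g f K') : Odd (K'.domRestrict '' F).ncard := by
  rw [ncard_domRestrict_image_eq_one hf h]
  exact odd_one

/-- Equate the value at z with the value at the pair `(l z, r z)`, which is kept; then l and r are
the only extensions. -/
theorem G_of_mem (hK : ∀ x, S.pair x x ∈ K) (hG : S.G (insert z K)) {l r : P → A}
    (hl : l ∈ S.fixLL K) (hr : r ∈ S.fixRR K) (ht : S.pair (l z) (r z) ∈ K) : S.G K := by
  classical
  by_cases hz : z ∈ K
  · rwa [Set.insert_eq_of_mem hz] at hG
  set t := S.pair (l z) (r z) with ht_def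
  have key : ∀ f : P → A, f z = f t → ∀ y ∈ insert z K, f (Function.update id z t y) = f y := by
    rintro f hf y (rfl | hy)
    · rw [Function.update_self, hf]
    · rw [Function.update_of_ne (by rintro rfl; exact hz hy), id]
  have hlt : l z = l t := by rw [hl.2 ht, ht_def, S.p_pair]
  have hrt : r z = r t := by rw [hr.2 ht, ht_def, S.q_pair]
  refine S.elim K (insert z K) (Function.update id z t) hK (Set.subset_insert _ _) hG ?_
    (odd_ncard_of_unique ⟨hl, key l hlt⟩ ?_) (odd_ncard_of_unique ⟨hr, key r hrt⟩ ?_)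
  · rintro y (rfl | hy)
    · rw [Function.update_self]
      exact Or.inr ht
    · rw [Function.update_of_ne (by rintro rfl; exact hz hy)]
      exact Or.inr hy
  · rintro f ⟨hf, hE⟩ y (rfl | hy)
    · have := hE y (Set.mem_insert _ _)
      rw [Function.update_self] at this
      rw [← this, hlt, hf.2 ht, hl.2 ht]
    · rw [hf.2 hy, hl.2 hy]
  · rintro f ⟨hf, hE⟩ y (rfl | hy)
    · have := hE y (Set.mem_insert _ _)
      rw [Function.update_self] at this
      rw [← this, hrt, hf.2 ht, hr.2 ht]
    · rw [hf.2 hy, hr.2 hy]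

theorem G_of_forall_eq (hK : ∀ x, S.pair x x ∈ K) (hG : S.G (insert z K))
    (hl : ∀ l ∈ S.fixLL K, l z = S.p z) (hr : ∀ r ∈ S.fixRR K, r z = S.q z) : S.G K := by
  refine S.elim K (insert z K) id hK (Set.subset_insert _ _) hG (fun _ h => h)
    (odd_ncard_of_unique ⟨p_mem_fixLL, fun _ _ => rfl⟩ ?_)
    (odd_ncard_of_unique ⟨q_mem_fixRR, fun _ _ => rfl⟩ ?_)
  · rintro f ⟨hf, -⟩ y (rfl | hy)
    · exact hl f hf
    · exact hf.2 hy
  · rintro f ⟨hf, -⟩ y (rfl | hy)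
    · exact hr f hf
    · exact hf.2 hy

/-- If at every pair the values of the two families meet or are all trivial, then all
nontrivial pairs can be eliminated. -/
theorem G_diagonal [Finite A] [Finite P]
    (h : ∀ z, (∃ l ∈ S.LL, ∃ r ∈ S.RR, l z = r z) ∨
      ((∀ l ∈ S.LL, l z = S.p z) ∧ ∀ r ∈ S.RR, r z = S.q z)) :
    S.G (Set.range fun x => S.pair x x) := by
  -- Choose the two operations with the fewest points of disagreement.
  obtain ⟨⟨l, r⟩, ⟨hl, hr⟩, hmin⟩ := Set.exists_min_image (S.LL ×ˢ S.RR)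
    (fun f => {z | f.1 z ≠ f.2 z}.ncard) (Set.toFinite _) ⟨(S.p, S.q), S.p_mem, S.q_mem⟩
  have triv : ∀ z, l z ≠ r z → (∀ l' ∈ S.LL, l' (S.pair (l z) (r z)) = l z) ∧
      ∀ r' ∈ S.RR, r' (S.pair (l z) (r z)) = r z := by
    intro z hz
    rcases h (S.pair (l z) (r z)) with ⟨l', hl', r', hr', h'⟩ | h'
    · exfalso
      -- Composition keeps every old agreement, by idempotence, and would create a new one at z.
      refine (hmin (fun z => l' (S.pair (l z) (r z)), fun z => r' (S.pair (l z) (r z)))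
        ⟨S.comp_LL l' hl' l hl r hr, S.comp_RR r' hr' l hl r hr⟩).not_gt
        (Set.ncard_lt_ncard ⟨fun y hy hyz => hy ?_, fun hsub => hsub (a := z) hz h'⟩)
      change l' (S.pair (l y) (r y)) = r' (S.pair (l y) (r y))
      change l y = r y at hyz
      rw [hyz, S.idem_LL l' hl', S.idem_RR r' hr']
    · simpa only [S.p_pair, S.q_pair] using h'
  have hE : ∀ z, l (S.pair (l z) (r z)) = l z ∧ r (S.pair (l z) (r z)) = r z := by
    intro z
    by_cases hz : l z = r z
    · rw [hz, S.idem_LL l hl, S.idem_RR r hr]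
      exact ⟨rfl, rfl⟩
    · exact ⟨(triv z hz).1 l hl, (triv z hz).2 r hr⟩
  -- Tie every z to `(l z, r z)`. That pair is diagonal or a point where both families are trivial,
  -- so all values are forced and l, r are the unique solutions.
  refine S.elim _ Set.univ (fun z => S.pair (l z) (r z)) (fun x => ⟨x, rfl⟩) (Set.subset_univ _)
    S.G_univ (fun _ _ => trivial)
    (odd_ncard_of_unique ⟨⟨hl, ?_⟩, fun z _ => (hE z).1⟩ ?_)
    (odd_ncard_of_unique ⟨⟨hr, ?_⟩, fun z _ => (hE z).2⟩ ?_)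
  · rintro _ ⟨x, rfl⟩
    simp only [S.idem_LL l hl, S.p_pair]
  · rintro f ⟨hf, hfE⟩ z -
    rw [← hfE z trivial]
    by_cases hz : l z = r z
    · rw [hz, S.idem_LL f hf.1]
      exact hz.symm
    · exact (triv z hz).1 f hf.1
  · rintro _ ⟨x, rfl⟩
    simp only [S.idem_RR r hr, S.q_pair]
  · rintro f ⟨hf, hfE⟩ z -
    rw [← hfE z trivial]
    by_cases hz : l z = r z
    · rw [hz, S.idem_RR f hf.1]
    · exact (triv z hz).2 f hf.1

/-- Elimination of the two pairs `(c, a)` and `(c, b)` at once. -/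
theorem G_or_swap {a b c : A} (hab : a ≠ b) (hK : ∀ x, S.pair x x ∈ K)
    (hG : S.G (insert (S.pair c a) (insert (S.pair c b) K)))
    (hl : ∀ l ∈ S.fixLL K, l (S.pair c a) = c ∧ l (S.pair c b) = c)
    (hr : ∀ r ∈ S.fixRR K, (r (S.pair c a) = a ∨ r (S.pair c a) = b) ∧
      (r (S.pair c b) = a ∨ r (S.pair c b) = b)) :
    S.G K ∨ (S.Sub {a, b} ∧ ∃ r ∈ S.fixRR K, r (S.pair c a) = b ∧ r (S.pair c b) = a) := by
  classical
  have hsub : K ⊆ insert (S.pair c a) (insert (S.pair c b) K) := fun z hz => Or.inr (Or.inr hz)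
  have eqL : ∀ l ∈ S.fixLL K, Set.EqOn l S.p (insert (S.pair c a) (insert (S.pair c b) K)) := by
    rintro l hl' z (rfl | rfl | hz)
    · rw [(hl l hl').1, S.p_pair]
    · rw [(hl l hl').2, S.p_pair]
    · exact hl'.2 hz
  have eqR : ∀ r ∈ S.fixRR K, ∀ r' ∈ S.fixRR K, r (S.pair c a) = r' (S.pair c a) →
      r (S.pair c b) = r' (S.pair c b) →
      Set.EqOn r r' (insert (S.pair c a) (insert (S.pair c b) K)) := by
    rintro r hr r' hr' h1 h2 z (rfl | rfl | hz)
    · exact h1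
    · exact h2
    · rw [hr.2 hz, hr'.2 hz]
  have qa : S.q (S.pair c a) = a := S.q_pair _ _
  have qb : S.q (S.pair c b) = b := S.q_pair _ _
  have oddL : Odd ((insert (S.pair c a) (insert (S.pair c b) K)).domRestrict '' S.fixLL K).ncard :=
    odd_ncard_of_unique p_mem_fixLL eqL
  have elim_id : Odd ((insert (S.pair c a) (insert (S.pair c b) K)).domRestrict '' S.fixRR K).ncard →
      S.G K := by
    intro hodd
    refine S.elim K _ id hK hsub hG (fun _ h => h) ?_ ?_
    · convert oddL using 4
      ext f
      exact and_iff_left fun _ _ => rfl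
    · convert hodd using 4
      ext f
      exact and_iff_left fun _ _ => rfl
  -- The alternative to plain counting: equate the two coordinates, so that only operations with
  -- equal values there are counted.
  have elim_tie : ∀ t ∈ S.fixRR K, t (S.pair c a) = t (S.pair c b) →
      (∀ r ∈ S.fixRR K, r (S.pair c a) = r (S.pair c b) → r (S.pair c a) = t (S.pair c a)) →
      S.G K := by
    intro t ht htt huniq
    have key : ∀ f : P → A, f (S.pair c a) = f (S.pair c b) →
        ∀ z, f (Function.update id (S.pair c a) (S.pair c b) z) = f z := by
      intro f hf z
      by_cases hz : z = S.pair c a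
      · rw [hz, Function.update_self, hf]
      · rw [Function.update_of_ne hz, id]
    refine S.elim K _ (Function.update id (S.pair c a) (S.pair c b)) hK hsub hG ?_
      (odd_ncard_of_unique ⟨p_mem_fixLL, fun z _ => key _ (by rw [S.p_pair, S.p_pair]) z⟩
        fun f hf => eqL f hf.1)
      (odd_ncard_of_unique ⟨ht, fun z _ => key _ htt z⟩ fun f hf => ?_)
    · intro z hz
      by_cases hza : z = S.pair c a
      · rw [hza, Function.update_self]
        exact Or.inr (Or.inl rfl)
      · rwa [Function.update_of_ne hza]
    · have h1 := hf.2 (S.pair c a) (Or.inl rfl)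
      rw [Function.update_self] at h1
      have h2 := huniq f hf.1 h1.symm
      exact eqR f hf.1 t ht h2 (by rw [h1, h2, htt])
  by_cases hba : ∃ r ∈ S.fixRR K, r (S.pair c a) = b ∧ r (S.pair c b) = a
  · refine Or.inr ⟨?_, hba⟩
    obtain ⟨s, hs, hs1, hs2⟩ := hba
    -- With the swap present, {a,b} is the value set at (c,a). If the constant value b is possible,
    -- fix (c,b) as well; otherwise the two values always differ and the first determines the
    -- second.
    by_cases hbb : ∃ r ∈ S.fixRR K, r (S.pair c a) = b ∧ r (S.pair c b) = b
    · obtain ⟨t, ht, ht1, ht2⟩ := hbb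
      convert S.sub_RR (insert (S.pair c b) K) _ (S.pair c a) (Set.subset_insert _ _) hG
        (Set.mem_insert _ _) ?_
      · apply Set.Subset.antisymm
        · rintro x (rfl | rfl)
          · exact ⟨S.q, q_mem_fixRR, qa⟩
          · refine ⟨t, ⟨ht.1, ?_⟩, ht1⟩
            rintro z (rfl | hz)
            · rw [ht2, qb]
            · exact ht.2 hz
        · rintro _ ⟨r, ⟨hr1, hr2⟩, rfl⟩
          exact (hr r ⟨hr1, hr2.mono (Set.subset_insert _ _)⟩).1
      · intro r h1 r' h1' h2
        refine eqR r ⟨h1.1, h1.2.mono (Set.subset_insert _ _)⟩ r'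
          ⟨h1'.1, h1'.2.mono (Set.subset_insert _ _)⟩ h2 ?_
        rw [h1.2 (Set.mem_insert _ _), h1'.2 (Set.mem_insert _ _)]
    · have hne : ∀ r ∈ S.fixRR K, r (S.pair c a) ≠ r (S.pair c b) := by
        intro r hr' heq
        rcases (hr r hr').1 with h1 | h1
        · refine hbb ⟨_, comp_mem_fixRR hs p_mem_fixLL hr', ?_, ?_⟩
          · simp only [S.p_pair, h1, hs1]
          · simp only [S.p_pair, ← heq, h1, hs1]
        · exact hbb ⟨r, hr', h1, heq ▸ h1⟩
      convert S.sub_RR K _ (S.pair c a) hsub hG (Set.mem_insert _ _) ?_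
      · apply Set.Subset.antisymm
        · rintro x (rfl | rfl)
          · exact ⟨S.q, q_mem_fixRR, qa⟩
          · exact ⟨s, hs, hs1⟩
        · rintro _ ⟨r, hr', rfl⟩
          exact (hr r hr').1
      · intro r h1 r' h1' h2
        refine eqR r h1 r' h1' h2 ?_
        have := hr r h1
        have := hr r' h1'
        have := hne r h1
        have := hne r' h1'
        grind
  left
  -- Without the swap, the value pairs are (a,b) and possibly (a,a), (b,b). One or three pairs are
  -- an odd number; for two pairs exactly one is constant, and equating the coordinates isolates it.
  by_cases haa : ∃ r ∈ S.fixRR K, r (S.pair c a) = a ∧ r (S.pair c b) = a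
  · by_cases hbb : ∃ r ∈ S.fixRR K, r (S.pair c a) = b ∧ r (S.pair c b) = b
    · obtain ⟨s, hs, hs1, hs2⟩ := haa
      obtain ⟨t, ht, ht1, ht2⟩ := hbb
      apply elim_id
      have : ((insert (S.pair c a) (insert (S.pair c b) K)).domRestrict '' S.fixRR K).ncard = 3 := by
        rw [Set.ncard_eq_three]
        have ma : S.pair c a ∈ insert (S.pair c a) (insert (S.pair c b) K) := Or.inl rfl
        have mb : S.pair c b ∈ insert (S.pair c a) (insert (S.pair c b) K) := Or.inr (Or.inl rfl)
        refine ⟨Set.domRestrict _ S.q, Set.domRestrict _ s, Set.domRestrict _ t, ?_, ?_, ?_, ?_⟩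
        · intro h
          have := congrFun h ⟨_, mb⟩
          simp only [Set.domRestrict_apply, qb, hs2] at this
          exact hab this.symm
        · intro h
          have := congrFun h ⟨_, ma⟩
          simp only [Set.domRestrict_apply, qa, ht1] at this
          exact hab this
        · intro h
          have := congrFun h ⟨_, ma⟩
          simp only [Set.domRestrict_apply, hs1, ht1] at this
          exact hab this
        · apply Set.Subset.antisymm
          · rintro _ ⟨r, hr', rfl⟩
            simp only [Set.mem_insert_iff, Set.mem_singleton_iff,
              Set.domRestrict_eq_domRestrict_iff]
            rcases hr r hr' with ⟨h1 | h1, h2 | h2⟩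
            · exact Or.inr (Or.inl (eqR r hr' s hs (h1.trans hs1.symm) (h2.trans hs2.symm)))
            · exact Or.inl (eqR r hr' _ q_mem_fixRR (h1.trans qa.symm) (h2.trans qb.symm))
            · exact (hba ⟨r, hr', h1, h2⟩).elim
            · exact Or.inr (Or.inr (eqR r hr' t ht (h1.trans ht1.symm) (h2.trans ht2.symm)))
          · rintro _ (rfl | rfl | rfl)
            · exact ⟨_, q_mem_fixRR, rfl⟩
            · exact ⟨_, hs, rfl⟩
            · exact ⟨_, ht, rfl⟩
      rw [this]
      decide
    · obtain ⟨s, hs, hs1, hs2⟩ := haa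
      refine elim_tie s hs (hs1.trans hs2.symm) fun r hr' heq => ?_
      rcases (hr r hr').1 with h1 | h1
      · rw [h1, hs1]
      · exact (hbb ⟨r, hr', h1, heq ▸ h1⟩).elim
  · by_cases hbb : ∃ r ∈ S.fixRR K, r (S.pair c a) = b ∧ r (S.pair c b) = b
    · obtain ⟨t, ht, ht1, ht2⟩ := hbb
      refine elim_tie t ht (ht1.trans ht2.symm) fun r hr' heq => ?_
      rcases (hr r hr').1 with h1 | h1
      · exact (haa ⟨r, hr', h1, heq ▸ h1⟩).elim
      · rw [h1, ht1]
    · refine elim_id (odd_ncard_of_unique q_mem_fixRR fun r hr' => ?_)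
      rcases hr r hr' with ⟨h1 | h1, h2 | h2⟩
      · exact (haa ⟨r, hr', h1, h2⟩).elim
      · exact eqR r hr' _ q_mem_fixRR (h1.trans qa.symm) (h2.trans qb.symm)
      · exact (hba ⟨r, hr', h1, h2⟩).elim
      · exact (hbb ⟨r, hr', h1, h2⟩).elim

/-- If the second family moves `(c, a)` to `(c, b)` while the first family fixes the value `c`,
then all nontrivial pairs can be eliminated, unless one of the families contains an operation
that acts nontrivially, as the transposition of `a` and `b`, for the single parameter `c`. -/
theorem G_diagonal_or_swap {a b c : A} (hab : a ≠ b) (hac : a ≠ c) (hbc : b ≠ c)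
    (hcov : ∀ x, x = a ∨ x = b ∨ x = c) (h1 : ∀ l ∈ S.LL, l (S.pair c a) = c)
    (h2 : ∃ r ∈ S.RR, r (S.pair c a) = b) (h3 : ∀ r ∈ S.RR, r (S.pair c a) ≠ c) :
    S.G (Set.range fun x => S.pair x x) ∨ (S.Sub {a, b} ∧
      ((∃ r ∈ S.RR, r (S.pair c a) = b ∧ r (S.pair c b) = a ∧ ∀ z, S.p z ≠ c → r z = S.q z) ∨
      ∃ l ∈ S.LL, l (S.pair a c) = b ∧ l (S.pair b c) = a ∧ ∀ z, S.q z ≠ c → l z = S.p z)) := by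
  obtain ⟨s, hs, hs1⟩ := h2
  have h1b : ∀ l ∈ S.LL, l (S.pair c b) = c := by
    intro l hl
    have := h1 _ (S.comp_LL l hl _ S.p_mem s hs)
    simpa only [S.p_pair, hs1] using this
  have h3b : ∀ r ∈ S.RR, r (S.pair c b) ≠ c := by
    intro r hr
    have := h3 _ (S.comp_RR r hr _ S.p_mem s hs)
    simpa only [S.p_pair, hs1] using this
  -- At (c,a) the members `S.q` and s of the second family take the values a and b. Combining them
  -- by f stays in that family, which never takes the value c there.
  have hclosed : ∀ f ∈ S.LL ∪ S.RR, f (S.pair a b) ≠ c ∧ f (S.pair b a) ≠ c := by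
    intro f hf
    have e1 := h3 _ (S.closed_RR f hf _ S.q_mem s hs)
    have e2 := h3 _ (S.closed_RR f hf s hs _ S.q_mem)
    simp only [S.q_pair, hs1] at e1 e2
    exact ⟨e1, e2⟩
  have hcases : ∀ {x}, x ≠ c → x = a ∨ x = b := by
    intro x hx
    have := hcov x
    tauto
  set D : Set P := Set.range fun x => S.pair x x with hD
  have hDmem : ∀ x, S.pair x x ∈ D := fun x => ⟨x, rfl⟩
  set X : Set P := insert (S.pair a b) (insert (S.pair b a) D) with hX
  have hXD : ∀ x, S.pair x x ∈ X := fun x => Or.inr (Or.inr (hDmem x))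
  have hXab : S.pair a b ∈ X := Or.inl rfl
  have hXba : S.pair b a ∈ X := Or.inr (Or.inl rfl)
  -- The coordinates that remain include all pairs whose first entry is not c, so a swap that fixes
  -- them is trivial for the other parameters.
  have row : S.G (insert (S.pair a c) (insert (S.pair b c) X)) ∨ (S.Sub {a, b} ∧
      ∃ r ∈ S.RR, r (S.pair c a) = b ∧ r (S.pair c b) = a ∧ ∀ z, S.p z ≠ c → r z = S.q z) := by
    have huniv : insert (S.pair c a) (insert (S.pair c b)
        (insert (S.pair a c) (insert (S.pair b c) X))) = Set.univ := by
      refine Set.eq_univ_of_forall fun z => ?_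
      rw [← S.pair_eta z]
      rcases hcov (S.p z) with h | h | h <;> rcases hcov (S.q z) with h' | h' | h' <;>
        rw [h, h'] <;> simp [hX, hDmem]
    refine (G_or_swap (K := insert (S.pair a c) (insert (S.pair b c) X)) hab
      (fun x => Or.inr (Or.inr (hXD x))) (huniv ▸ S.G_univ)
      (fun l hl => ⟨h1 l hl.1, h1b l hl.1⟩)
      (fun r hr => ⟨hcases (h3 r hr.1), hcases (h3b r hr.1)⟩)).imp_right ?_
    rintro ⟨hsub, r, hr, hr1, hr2⟩
    refine ⟨hsub, r, hr.1, hr1, hr2, fun z hz => hr.2 ?_⟩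
    rw [← S.pair_eta z]
    rcases hcases hz with h | h <;> rcases hcov (S.q z) with h' | h' | h' <;>
      rw [h, h'] <;> simp [hX, hDmem]
  rcases row with row | ⟨hsub, hr⟩
  swap
  · exact Or.inr ⟨hsub, Or.inl hr⟩
  have column : S.G X ∨ (S.Sub {a, b} ∧
      ∃ l ∈ S.LL, l (S.pair a c) = b ∧ l (S.pair b c) = a ∧ ∀ z, S.q z ≠ c → l z = S.p z) := by
    have hbcX : S.G (insert (S.pair b c) X) := by
      have hK : ∀ x, S.pair x x ∈ insert (S.pair b c) X := fun x => Or.inr (hXD x)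
      by_cases hmeet : ∃ l ∈ S.fixLL (insert (S.pair b c) X), ∃ r ∈ S.fixRR (insert (S.pair b c) X),
          S.pair (l (S.pair a c)) (r (S.pair a c)) ∈ insert (S.pair b c) X
      · obtain ⟨l, hl, r, hr, h⟩ := hmeet
        exact G_of_mem hK row hl hr h
      · push Not at hmeet
        refine G_of_forall_eq hK row (fun l hl => ?_) fun r hr => ?_
        · have := hmeet l hl _ q_mem_fixRR
          rw [S.q_pair] at this
          rw [S.p_pair]
          rcases hcov (l (S.pair a c)) with h | h | h
          · exact h
          · exact (this (h ▸ Or.inl rfl)).elim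
          · exact (this (by rw [h]; exact hK c)).elim
        · have := hmeet _ p_mem_fixLL r hr
          rw [S.p_pair] at this
          rw [S.q_pair]
          rcases hcov (r (S.pair a c)) with h | h | h
          · exact (this (by rw [h]; exact hK a)).elim
          · exact (this (by rw [h]; exact Or.inr hXab)).elim
          · exact h
    by_cases hmeet : ∃ l ∈ S.fixLL X, ∃ r ∈ S.fixRR X, S.pair (l (S.pair b c)) (r (S.pair b c)) ∈ X
    · obtain ⟨l, hl, r, hr, h⟩ := hmeet
      exact Or.inl (G_of_mem hXD hbcX hl hr h)
    push Not at hmeet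
    have hl_ne : ∀ l ∈ S.fixLL X, l (S.pair b c) ≠ c := by
      intro l hl h
      refine hmeet l hl _ q_mem_fixRR ?_
      rw [h, S.q_pair]
      exact hXD c
    have hr_eq : ∀ r ∈ S.fixRR X, r (S.pair b c) = c := by
      intro r hr
      have := hmeet _ p_mem_fixLL r hr
      rw [S.p_pair] at this
      rcases hcov (r (S.pair b c)) with h | h | h
      · exact (this (by rw [h]; exact hXba)).elim
      · exact (this (by rw [h]; exact hXD b)).elim
      · exact h
    by_cases hall : ∀ l ∈ S.fixLL X, l (S.pair b c) = b
    · exact Or.inl (G_of_forall_eq hXD hbcX (by simpa only [S.p_pair] using hall)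
        (by simpa only [S.q_pair] using hr_eq))
    push Not at hall
    obtain ⟨t, ht, htb⟩ := hall
    have hta : t (S.pair b c) = a := (hcases (hl_ne t ht)).resolve_right htb
    have hr_eq' : ∀ r ∈ S.fixRR X, r (S.pair a c) = c := by
      intro r hr
      have := hr_eq _ (comp_mem_fixRR hr ht q_mem_fixRR)
      simpa only [hta, S.q_pair] using this
    have hl_ne' : ∀ l ∈ S.fixLL X, l (S.pair a c) ≠ c := by
      intro l hl
      have := hl_ne _ (comp_mem_fixLL hl ht q_mem_fixRR)
      simpa only [hta, S.q_pair] using this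
    -- Here (b,c) cannot be removed alone: t moves it to (a,c). Composing with t carries the
    -- constraints at (b,c) over to (a,c), so both are removed together in the dual system, starting
    -- again from `row`.
    refine (G_or_swap (S := S.dual) (K := X) (c := c) hab hXD row
      (fun r hr => ⟨hr_eq' r hr, hr_eq r hr⟩)
      (fun l hl => ⟨hcases (hl_ne' l hl), hcases (hl_ne l hl)⟩)).imp_right ?_
    rintro ⟨hsub, l, hl, hl1, hl2⟩
    refine ⟨hsub, l, hl.1, hl1, hl2, fun z hz => ?_⟩
    rw [← S.pair_eta z]
    rcases hcov (S.p z) with h | h | h <;> rcases hcases hz with h' | h' <;> rw [h, h', S.p_pair]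
    · exact S.idem_LL l hl.1 a
    · exact (hl.2 hXab).trans (S.p_pair _ _)
    · exact (hl.2 hXba).trans (S.p_pair _ _)
    · exact S.idem_LL l hl.1 b
    · exact h1 l hl.1
    · exact h1b l hl.1
  rcases column with column | ⟨hsub, hl⟩
  swap
  · exact Or.inr ⟨hsub, Or.inr hl⟩
  left
  -- On {a,b} a nontrivial value of either family can be matched on the diagonal.
  have within : ∀ {K : Set P} {x y : A}, (∀ x, S.pair x x ∈ K) → (x = a ∧ y = b ∨ x = b ∧ y = a) →
      S.G (insert (S.pair x y) K) → S.G K := by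
    intro K x y hK hxy hG
    have hv : ∀ f ∈ S.LL ∪ S.RR, f (S.pair x y) = x ∨ f (S.pair x y) = y := by
      intro f hf
      have := hclosed f hf
      rcases hxy with ⟨rfl, rfl⟩ | ⟨rfl, rfl⟩
      · exact hcases this.1
      · exact (hcases this.2).symm
    by_cases hl : ∃ l ∈ S.fixLL K, l (S.pair x y) = y
    · obtain ⟨l, hl, hly⟩ := hl
      refine G_of_mem hK hG hl q_mem_fixRR ?_
      rw [hly, S.q_pair]
      exact hK y
    by_cases hr : ∃ r ∈ S.fixRR K, r (S.pair x y) = x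
    · obtain ⟨r, hr, hrx⟩ := hr
      refine G_of_mem hK hG p_mem_fixLL hr ?_
      rw [hrx, S.p_pair]
      exact hK x
    refine G_of_forall_eq hK hG (fun l hl' => ?_) fun r hr' => ?_
    · rw [S.p_pair]
      exact (hv l (Or.inl hl'.1)).resolve_right fun h => hl ⟨l, hl', h⟩
    · rw [S.q_pair]
      exact (hv r (Or.inr hr'.1)).resolve_left fun h => hr ⟨r, hr', h⟩
  exact within hDmem (Or.inr ⟨rfl, rfl⟩) (within (fun x => Or.inr (hDmem x)) (Or.inl ⟨rfl, rfl⟩)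
    column)

theorem exists_third (hA : Nat.card A = 3) {u v : A} (huv : u ≠ v) :
    ∃ w, u ≠ w ∧ v ≠ w ∧ ∀ x, x = u ∨ x = v ∨ x = w := by
  classical
  have := Nat.finite_of_card_ne_zero (α := A) (by omega)
  have := Fintype.ofFinite A
  rw [Nat.card_eq_fintype_card] at hA
  obtain ⟨w, hw⟩ : ∃ w, w ∉ ({u, v} : Finset A) := by
    by_contra! h
    have h1 : ({u, v} : Finset A) = Finset.univ := Finset.eq_univ_of_forall h
    have h2 := Finset.card_pair huv
    rw [h1, Finset.card_univ] at h2
    omega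
  simp only [Finset.mem_insert, Finset.mem_singleton, not_or] at hw
  have h1 : ({u, v, w} : Finset A) = Finset.univ := by
    rw [← Finset.card_eq_iff_eq_univ, hA, Finset.card_eq_three]
    exact ⟨u, v, w, huv, Ne.symm hw.1, Ne.symm hw.2, rfl⟩
  refine ⟨w, Ne.symm hw.1, Ne.symm hw.2, fun x => ?_⟩
  have := h1 ▸ Finset.mem_univ x
  simpa using this

/-- Over three elements all nontrivial pairs can be eliminated, unless one of the families contains
an operation acting as a transposition for one parameter and trivially for the others. -/
theorem G_diagonal_or_exists_swap (hA : Nat.card A = 3) [Finite P] :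
    S.G (Set.range fun x => S.pair x x) ∨ ∃ a b c : A, a ≠ b ∧ a ≠ c ∧ b ≠ c ∧
      (∀ x, x = a ∨ x = b ∨ x = c) ∧ S.Sub {a, b} ∧
      ((∃ r ∈ S.RR, r (S.pair c a) = b ∧ r (S.pair c b) = a ∧ ∀ z, S.p z ≠ c → r z = S.q z) ∨
      ∃ l ∈ S.LL, l (S.pair a c) = b ∧ l (S.pair b c) = a ∧ ∀ z, S.q z ≠ c → l z = S.p z) := by
  have := Nat.finite_of_card_ne_zero (α := A) (by omega)
  by_cases h : ∀ z, (∃ l ∈ S.LL, ∃ r ∈ S.RR, l z = r z) ∨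
      ((∀ l ∈ S.LL, l z = S.p z) ∧ ∀ r ∈ S.RR, r z = S.q z)
  · exact Or.inl (G_diagonal h)
  push Not at h
  obtain ⟨z, hne, hnt⟩ := h
  have hpq := hne _ S.p_mem _ S.q_mem
  obtain ⟨w, hpw, hqw, hcov⟩ := exists_third hA hpq
  -- The two value sets at z are disjoint subsets of three elements, so whichever family attains w,
  -- the other is trivial at z.
  by_cases hl : ∃ l ∈ S.LL, l z = w
  · obtain ⟨l, hl, hlz⟩ := hl
    have hr : ∀ r ∈ S.RR, r z = S.q z := by
      intro r hr
      have e1 := hne _ S.p_mem r hr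
      have e2 := hne l hl r hr
      rcases hcov (r z) with e | e | e
      · exact (e1 e.symm).elim
      · exact e
      · exact (e2 (hlz.trans e.symm)).elim
    have key := G_diagonal_or_swap (S := S.dual) (a := S.p z) (b := w) (c := S.q z) hpw hpq hqw.symm
      (fun x => by have := hcov x; tauto)
      (by change ∀ r ∈ S.RR, r (S.pair (S.p z) (S.q z)) = S.q z; rwa [S.pair_eta])
      (by
        change ∃ l ∈ S.LL, l (S.pair (S.p z) (S.q z)) = w
        rw [S.pair_eta]
        exact ⟨l, hl, hlz⟩)
      (by
        change ∀ l ∈ S.LL, l (S.pair (S.p z) (S.q z)) ≠ S.q z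
        rw [S.pair_eta]
        exact fun l hl => hne l hl _ S.q_mem)
    rcases key with key | ⟨hsub, key⟩
    · exact Or.inl key
    · exact Or.inr ⟨S.p z, w, S.q z, hpw, hpq, hqw.symm, fun x => by have := hcov x; tauto,
        hsub, key.symm⟩
  · have hl' : ∀ l ∈ S.LL, l z = S.p z := by
      intro l hl1
      rcases hcov (l z) with e | e | e
      · exact e
      · exact (hne l hl1 _ S.q_mem e).elim
      · exact (hl ⟨l, hl1, e⟩).elim
    obtain ⟨r, hr, hrz⟩ := hnt hl'
    have hrw : r z = w := by
      rcases hcov (r z) with e | e | e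
      · exact (hne _ S.p_mem r hr e.symm).elim
      · exact (hrz e).elim
      · exact e
    have key := G_diagonal_or_swap (S := S) (a := S.q z) (b := w) (c := S.p z) hqw hpq.symm
      hpw.symm (fun x => by have := hcov x; tauto) (by rwa [S.pair_eta])
      (by rw [S.pair_eta]; exact ⟨r, hr, hrw⟩)
      (by rw [S.pair_eta]; exact fun r hr h => hne _ S.p_mem r hr h.symm)
    rcases key with key | ⟨hsub, key⟩
    · exact Or.inl key
    · exact Or.inr ⟨S.q z, w, S.p z, hqw, hpq.symm, hpw.symm, fun x => by have := hcov x; tauto,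
        hsub, key⟩

end ElimSystem

/-! ### Mal'tsev polymorphisms and indicator obstructions -/

section Obstruction

variable {p : ℕ} {L : FirstOrder.Language.{u, v}} {A : Type w} [L.Structure A]

theorem triple_left_mem (x y : A) : ![x, y, y] ∈ coordI A ∪ coordJ A :=
  Or.inl ⟨x, y, rfl⟩

theorem triple_right_mem (x y : A) : ![y, y, x] ∈ coordI A ∪ coordJ A := by
  by_cases h : x = y
  · exact Or.inl ⟨y, x, by rw [h]⟩
  · exact Or.inr ⟨x, y, h, rfl⟩

theorem stronglyPRectangular_of_hasMaltsevPolymorphism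
    (h : HasMaltsevPolymorphism (mppRelations p L A)) : StronglyPRectangular p L A := by
  classical
  obtain ⟨m, hm, hxy⟩ := h
  intro R hR _ I a b c d hac had hbc
  -- On I this is m(b,a,a) = b, off I it is m(c,c,d) = d.
  have := hm R hR ![I.piecewise b c, I.piecewise a c, I.piecewise a d]
    (by intro j; fin_cases j <;> assumption)
  convert this using 1
  funext i
  have h1 : (fun j => (![I.piecewise b c, I.piecewise a c, I.piecewise a d] : Fin 3 → _) j i) =
      ![I.piecewise b c i, I.piecewise a c i, I.piecewise a d i] := by
    funext j
    fin_cases j <;> rfl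
  rw [h1]
  by_cases hi : i ∈ I
  · simp only [Set.piecewise_eq_of_mem _ _ _ hi, (hxy _ _).1]
  · simp only [Set.piecewise_eq_of_notMem _ _ _ hi, (hxy _ _).2]

/-- The three projections supply the required tuples, and the forbidden tuple would come from a
Mal'tsev polymorphism. -/
theorem admitsIndicatorObstruction_of_mppDefinable [Finite A] [Nonempty A] (hp : p.Prime)
    (hG : MppDefinable p L (cylinder p L (coordI A ∪ coordJ A)))
    (hm : ¬ HasMaltsevPolymorphism (mppRelations p L A)) : AdmitsIndicatorObstruction p L A := by
  classical
  obtain ⟨x₀⟩ := ‹Nonempty A›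
  refine ⟨{x | ∃ ψ ∈ ternaryPol p L A, ∀ z : CoordIJ A, ψ z.1 = x z}, ⟨?_, ?_, ?_, ?_, ?_⟩, ?_⟩
  · rintro x ⟨ψ, hψ, hx⟩
    exact ⟨ψ, ternaryPol_subset_indicator hp hψ, funext hx⟩
  · refine ⟨proj 0, proj_mem_ternaryPol 0, fun z => ?_⟩
    unfold joinIJ
    split_ifs <;> rfl
  · refine ⟨proj 1, proj_mem_ternaryPol 1, fun z => ?_⟩
    unfold joinIJ
    split_ifs with h
    · rfl
    · obtain ⟨a, b, -, hz⟩ := z.2.resolve_left h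
      simp [proj, tupleC, hz]
  · refine ⟨proj 2, proj_mem_ternaryPol 2, fun z => ?_⟩
    unfold joinIJ
    split_ifs with h
    · obtain ⟨a, b, hz⟩ := h
      simp [proj, tupleB, hz]
    · rfl
  · rintro ⟨ψ, hψ, h⟩
    refine hm ⟨ψ, hψ, fun x y => ⟨?_, ?_⟩⟩
    · rw [h ⟨![x, y, y], triple_left_mem x y⟩, joinIJ, dif_pos ⟨x, y, rfl⟩]
      rfl
    · rw [h ⟨![y, y, x], triple_right_mem x y⟩, joinIJ]
      split_ifs with hI
      · obtain ⟨a, b, hz⟩ := hI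
        have h1 := congrFun hz 1
        have h2 := congrFun hz 2
        simp only [Matrix.cons_val] at h1 h2
        simp [tupleA, h1, h2]
      · rfl
  -- Coordinates outside I ∪ J may be sent anywhere, since the cylinder ignores them.
  · convert hG.comp (fun z => if h : z ∈ coordI A ∪ coordJ A then (⟨z, h⟩ : CoordIJ A) else
      ⟨![x₀, x₀, x₀], triple_left_mem x₀ x₀⟩) using 1
    ext x
    constructor
    · rintro ⟨ψ, hψ, h⟩
      refine ⟨ψ, hψ, fun z hz => ?_⟩
      simpa only [dif_pos hz] using h ⟨z, hz⟩
    · rintro ⟨ψ, hψ, h⟩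
      refine ⟨ψ, hψ, fun z => ?_⟩
      have := h z.2
      simpa only [dif_pos z.2] using this

end Obstruction

/-! ### Elimination of single coordinates -/

section Single

variable {p : ℕ} {L : FirstOrder.Language.{u, v}} {A : Type w} [L.Structure A]

/-- A common value of two neighbouring projections at z yields a triple in I ∪ J to which z can be
tied. Otherwise no value set is all of A, so its size is 1 or 2. -/
theorem mppDefinable_cylinder_of_odd (hA : Nat.card A = 3) (hp : p.Prime) (hp2 : p ≠ 2) :
    MppDefinable p L (cylinder p L (coordI A ∪ coordJ A)) := by
  have := Nat.finite_of_card_ne_zero (α := A) (by omega)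
  refine mppDefinable_cylinder_of_forall (fun W hW z hG => ?_) (mppDefinable_cylinder_univ hp)
  by_cases h01 : ∃ φ ∈ polFixing p L 0 W, ∃ ψ ∈ polFixing p L 1 W, φ z = ψ z
  · obtain ⟨φ, hφ, ψ, hψ, h⟩ := h01
    refine mppDefinable_cylinder_of_mem hp hG (hW (triple_right_mem (z 2) (φ z))) fun i => ?_
    fin_cases i
    · exact ⟨φ, hφ, rfl⟩
    · exact ⟨ψ, hψ, h.symm⟩
    · exact ⟨_, proj_mem_polFixing 2 W, rfl⟩
  by_cases h12 : ∃ φ ∈ polFixing p L 1 W, ∃ ψ ∈ polFixing p L 2 W, φ z = ψ z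
  · obtain ⟨φ, hφ, ψ, hψ, h⟩ := h12
    refine mppDefinable_cylinder_of_mem hp hG (hW (triple_left_mem (z 0) (φ z))) fun i => ?_
    fin_cases i
    · exact ⟨_, proj_mem_polFixing 0 W, rfl⟩
    · exact ⟨φ, hφ, rfl⟩
    · exact ⟨ψ, hψ, h.symm⟩
  push Not at h01 h12
  refine mppDefinable_cylinder_of_ncard hp hG fun i hd => ?_
  have hpos : 0 < ((fun φ => φ z) '' polFixing p L i W).ncard :=
    (Set.ncard_pos).2 ⟨_, _, proj_mem_polFixing i W, rfl⟩
  have hlt : ((fun φ => φ z) '' polFixing p L i W).ncard < 3 := by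
    refine (Set.ncard_lt_card fun huniv => ?_).trans_eq hA
    have hsurj : ∀ x, ∃ φ ∈ polFixing p L i W, φ z = x := fun x => by
      have : x ∈ (fun φ => φ z) '' polFixing p L i W := huniv ▸ trivial
      exact this
    fin_cases i
    · obtain ⟨φ, hφ, h⟩ := hsurj (z 1)
      exact h01 φ hφ _ (proj_mem_polFixing 1 W) h
    · obtain ⟨φ, hφ, h⟩ := hsurj (z 0)
      exact h01 _ (proj_mem_polFixing 0 W) φ hφ h.symm
    · obtain ⟨φ, hφ, h⟩ := hsurj (z 1)
      exact h12 _ (proj_mem_polFixing 1 W) φ hφ h.symm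
  have := Nat.le_of_dvd hpos hd
  have := hp.two_le
  omega

/-- The triple `(x, y, x)` for a pair `(x, y)`. -/
def dbl (z : A × A) : Fin 3 → A := ![z.1, z.2, z.1]

theorem eq_dbl {z : Fin 3 → A} (h : z 0 = z 2) : z = dbl (z 0, z 1) := by
  funext i
  fin_cases i
  · rfl
  · rfl
  · exact h.symm

/-- With the triples (x,y,x) kept, any coincidence between two of the three value sets at z allows
tying. Failing this, they are pairwise disjoint in a three-element set, hence singletons. -/
theorem mppDefinable_cylinder_dbl (hA : Nat.card A = 3) (hp : p.Prime) :
    MppDefinable p L (cylinder p L (coordI A ∪ coordJ A ∪ dbl '' Set.univ)) := by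
  have := Nat.finite_of_card_ne_zero (α := A) (by omega)
  refine mppDefinable_cylinder_of_forall (fun W hW z hG => ?_) (mppDefinable_cylinder_univ hp)
  by_cases h : ∃ φ : Fin 3 → (Fin 3 → A) → A, (∀ i, φ i ∈ polFixing p L i W) ∧
      (fun i => φ i z) ∈ W
  · obtain ⟨φ, hφ, h⟩ := h
    exact mppDefinable_cylinder_of_mem hp hG h fun i => ⟨φ i, hφ i, rfl⟩
  have key : ∀ φ ∈ polFixing p L 0 W, ∀ ψ ∈ polFixing p L 1 W, ∀ χ ∈ polFixing p L 2 W,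
      φ z ≠ ψ z ∧ ψ z ≠ χ z ∧ φ z ≠ χ z := by
    intro φ hφ ψ hψ χ hχ
    have hW' : ![φ z, ψ z, χ z] ∉ W := by
      intro hmem
      refine h ⟨![φ, ψ, χ], ?_, ?_⟩
      · intro i
        fin_cases i <;> assumption
      · convert hmem using 1
        funext i
        fin_cases i <;> rfl
    refine ⟨fun e => hW' (hW (Or.inl ?_)), fun e => hW' (hW (Or.inl ?_)),
      fun e => hW' (hW (Or.inr ?_))⟩
    · rw [e]
      exact triple_right_mem _ _
    · rw [e]
      exact triple_left_mem _ _
    · rw [e]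
      exact ⟨(χ z, ψ z), trivial, rfl⟩
  have p0 := proj_mem_polFixing (p := p) (L := L) (A := A) 0 W
  have p1 := proj_mem_polFixing (p := p) (L := L) (A := A) 1 W
  have p2 := proj_mem_polFixing (p := p) (L := L) (A := A) 2 W
  obtain ⟨e01, e12, e02⟩ := key _ p0 _ p1 _ p2
  obtain ⟨w, -, -, hcov⟩ := ElimSystem.exists_third hA e01
  have hcov' : ∀ x, x = proj 0 z ∨ x = proj 1 z ∨ x = proj 2 z := by
    intro x
    have h1 := hcov x
    have h2 := hcov (proj 2 z)
    grind
  refine mppDefinable_cylinder_of_ncard hp hG fun i => ?_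
  have : (fun φ => φ z) '' polFixing p L i W = {proj i z} := by
    refine Set.eq_singleton_iff_unique_mem.2 ⟨⟨_, proj_mem_polFixing i W, rfl⟩, ?_⟩
    rintro _ ⟨φ, hφ, rfl⟩
    have h1 := hcov' (φ z)
    fin_cases i
    · have h2 := key φ hφ _ p1 _ p2
      tauto
    · have h2 := key _ p0 φ hφ _ p2
      have h3 := h2.1.symm
      tauto
    · have h2 := key _ p0 _ p1 φ hφ
      have h3 := h2.2.1.symm
      have h4 := h2.2.2.symm
      tauto
  rw [this, Set.ncard_singleton]
  exact fun h1 => hp.one_lt.ne' (Nat.dvd_one.1 h1)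

end Single

/-! ### The system of binary operations obtained from the triples `(x, y, x)` -/

section Binary

variable {p : ℕ} {L : FirstOrder.Language.{u, v}} {A : Type w} [L.Structure A]

variable (p L A) in
/-- The binary operations `f(x, y) = φ(x, y, x)` for the ternary polymorphisms `φ` that agree with
the `i`-th projection on the triples `(x, y, y)` and `(y, y, x)`. -/
def binaryFamily (i : Fin 3) : Set (A × A → A) :=
  {l | ∃ φ ∈ polFixing p L i (coordI A ∪ coordJ A), ∀ z, l z = φ (dbl z)}

theorem polFixing_comp [Finite A] (hp : p.Prime) {i : Fin 3} {W : Set (Fin 3 → A)}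
    {φ : (Fin 3 → A) → A} (hφ : φ ∈ polFixing p L i W) {ψ : Fin 3 → (Fin 3 → A) → A}
    (hψ : ∀ j, ψ j ∈ polFixing p L j W) : (fun z => φ fun j => ψ j z) ∈ polFixing p L i W := by
  refine ⟨ternaryPol_comp_mem hp hφ.1 ψ fun j => (hψ j).1, fun z hz => ?_⟩
  have : (fun j => ψ j z) = z := funext fun j => (hψ j).2 hz
  simp only [this]
  exact hφ.2 hz

theorem polFixing_idem {i : Fin 3} {φ : (Fin 3 → A) → A}
    (hφ : φ ∈ polFixing p L i (coordI A ∪ coordJ A)) (x : A) : φ ![x, x, x] = x := by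
  rw [hφ.2 (triple_left_mem x x)]
  fin_cases i <;> rfl

/-- On I ∪ J all three inner operations take the same value, and the outer one is idempotent, so its
own index k does not matter. -/
theorem polFixing_closed [Finite A] (hp : p.Prime) {i k : Fin 3} {φ : (Fin 3 → A) → A}
    (hφ : φ ∈ polFixing p L k (coordI A ∪ coordJ A)) {ψ : Fin 3 → (Fin 3 → A) → A}
    (hψ : ∀ j, ψ j ∈ polFixing p L i (coordI A ∪ coordJ A)) :
    (fun z => φ fun j => ψ j z) ∈ polFixing p L i (coordI A ∪ coordJ A) := by
  refine ⟨ternaryPol_comp_mem hp hφ.1 ψ fun j => (hψ j).1, fun z hz => ?_⟩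
  have : (fun j => ψ j z) = ![z i, z i, z i] := by
    funext j
    rw [(hψ j).2 hz]
    fin_cases j <;> rfl
  simp only [this]
  exact polFixing_idem hφ _

theorem polFixing_mirror [Finite A] (hp : p.Prime) {i k : Fin 3}
    (hik : ∀ z : Fin 3 → A, ![z 2, z 1, z 0] i = z k) {φ : (Fin 3 → A) → A}
    (hφ : φ ∈ polFixing p L i (coordI A ∪ coordJ A)) :
    (fun z => φ ![z 2, z 1, z 0]) ∈ polFixing p L k (coordI A ∪ coordJ A) := by
  constructor
  · convert ternaryPol_comp_mem hp hφ.1 ![proj 2, proj 1, proj 0] ?_ using 3 with z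
    · funext j
      fin_cases j <;> rfl
    · intro j
      fin_cases j <;> exact proj_mem_ternaryPol _
  · intro z hz
    refine (hφ.2 ?_).trans (hik z)
    rcases hz with ⟨a, b, rfl⟩ | ⟨a, b, -, rfl⟩
    · exact triple_right_mem a b
    · exact triple_left_mem a b

/-- Reversing triples preserves I ∪ J, exchanges the first and third projections, and fixes every
(x,y,x). -/
theorem binaryFamily_two [Finite A] (hp : p.Prime) : binaryFamily p L A 2 = binaryFamily p L A 0 := by
  ext l
  constructor
  · rintro ⟨φ, hφ, h⟩
    exact ⟨_, polFixing_mirror hp (fun _ => rfl) hφ, h⟩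
  · rintro ⟨φ, hφ, h⟩
    exact ⟨_, polFixing_mirror hp (fun _ => rfl) hφ, h⟩

theorem proj_mem_binaryFamily (i : Fin 3) : (fun z => proj i (dbl z)) ∈ binaryFamily p L A i :=
  ⟨_, proj_mem_polFixing i _, fun _ => rfl⟩

theorem binaryFamily_idem {i : Fin 3} {l : A × A → A} (hl : l ∈ binaryFamily p L A i) (x : A) :
    l (x, x) = x := by
  obtain ⟨φ, hφ, h⟩ := hl
  rw [h]
  exact polFixing_idem hφ x

theorem binaryFamily_comp [Finite A] (hp : p.Prime) {i : Fin 3} {f l r : A × A → A}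
    (hf : f ∈ binaryFamily p L A i) (hl : l ∈ binaryFamily p L A 0)
    (hr : r ∈ binaryFamily p L A 1) : (fun z => f (l z, r z)) ∈ binaryFamily p L A i := by
  have hl' := hl
  rw [← binaryFamily_two hp] at hl'
  obtain ⟨φ, hφ, h⟩ := hf
  obtain ⟨ψ₀, hψ₀, h₀⟩ := hl
  obtain ⟨ψ₁, hψ₁, h₁⟩ := hr
  obtain ⟨ψ₂, hψ₂, h₂⟩ := hl'
  refine ⟨_, polFixing_comp hp hφ (ψ := ![ψ₀, ψ₁, ψ₂]) ?_, fun z => ?_⟩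
  · intro j
    fin_cases j <;> assumption
  · simp only [h]
    congr 1
    funext j
    fin_cases j
    · exact h₀ z
    · exact h₁ z
    · exact h₂ z

theorem binaryFamily_closed [Finite A] (hp : p.Prime) {i k : Fin 3} {f l l' : A × A → A}
    (hf : f ∈ binaryFamily p L A k) (hl : l ∈ binaryFamily p L A i)
    (hl' : l' ∈ binaryFamily p L A i) : (fun z => f (l z, l' z)) ∈ binaryFamily p L A i := by
  obtain ⟨φ, hφ, h⟩ := hf
  obtain ⟨ψ₀, hψ₀, h₀⟩ := hl
  obtain ⟨ψ₁, hψ₁, h₁⟩ := hl'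
  refine ⟨_, polFixing_closed hp hφ (ψ := ![ψ₀, ψ₁, ψ₀]) ?_, fun z => ?_⟩
  · intro j
    fin_cases j <;> assumption
  · simp only [h]
    congr 1
    funext j
    fin_cases j
    · exact h₀ z
    · exact h₁ z
    · exact h₀ z

/-- The coordinates `(x, y, y)`, `(y, y, x)`, and those `(x, y, x)` for which `(x, y) ∈ K`. -/
def coordDbl (K : Set (A × A)) : Set (Fin 3 → A) := coordI A ∪ coordJ A ∪ dbl '' K

theorem coordDbl_mono {K K' : Set (A × A)} (h : K ⊆ K') : coordDbl K ⊆ coordDbl K' :=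
  Set.union_subset_union_right _ (Set.image_mono h)

theorem dbl_mem_coordDbl {K : Set (A × A)} {z : A × A} (hz : z ∈ K) : dbl z ∈ coordDbl K :=
  Or.inr ⟨z, hz, rfl⟩

theorem mem_of_mem_coordDbl {K : Set (A × A)} (hK : ∀ x, (x, x) ∈ K) {z : Fin 3 → A}
    (hz : z ∈ coordDbl K) (h : z 0 = z 2) : (z 0, z 1) ∈ K := by
  rcases hz with (⟨a, b, rfl⟩ | ⟨a, b, -, rfl⟩) | ⟨y, hy, rfl⟩
  · simp only [Matrix.cons_val] at h ⊢
    rw [h]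
    exact hK b
  · exact hK b
  · exact hy

theorem mem_polFixing_coordDbl {i : Fin 3} {K : Set (A × A)} {φ : (Fin 3 → A) → A} :
    φ ∈ polFixing p L i (coordDbl K) ↔ φ ∈ polFixing p L i (coordI A ∪ coordJ A) ∧
      Set.EqOn (fun z => φ (dbl z)) (fun z => proj i (dbl z)) K := by
  constructor
  · exact fun h => ⟨⟨h.1, h.2.mono Set.subset_union_left⟩, fun z hz => h.2 (dbl_mem_coordDbl hz)⟩
  · rintro ⟨h1, h2⟩
    refine ⟨h1.1, ?_⟩
    rintro z (hz | ⟨y, hy, rfl⟩)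
    · exact h1.2 hz
    · exact h2 hy

-- Triples in I ∪ J carry forced values, so restricting to the coordinates (x,y,x) loses nothing.
-- This translates the counts of the elimination lemma into counts of binary operations.
open Classical in
theorem ncard_domRestrict_coordDbl {i : Fin 3} {K K' : Set (A × A)} (hK : ∀ x, (x, x) ∈ K)
    (hKK : K ⊆ K') (E : A × A → A × A) :
    ((coordDbl K').domRestrict '' {φ | φ ∈ polFixing p L i (coordDbl K) ∧ ∀ z ∈ coordDbl K',
      φ (if z 0 = z 2 then dbl (E (z 0, z 1)) else z) = φ z}).ncard =
    (K'.domRestrict '' {l | (l ∈ binaryFamily p L A i ∧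
      Set.EqOn l (fun z => proj i (dbl z)) K) ∧ ∀ z ∈ K', l (E z) = l z}).ncard := by
  rw [← Set.InjOn.ncard_image (f := fun (g : coordDbl K' → A) (z : K') =>
    g ⟨dbl z.1, dbl_mem_coordDbl z.2⟩)]
  · congr 1
    ext g
    constructor
    · rintro ⟨_, ⟨φ, ⟨hφ, hE⟩, rfl⟩, rfl⟩
      rw [mem_polFixing_coordDbl] at hφ
      refine ⟨fun z => φ (dbl z), ⟨⟨⟨φ, hφ.1, fun _ => rfl⟩, hφ.2⟩, fun z hz => ?_⟩, rfl⟩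
      have := hE (dbl z) (dbl_mem_coordDbl hz)
      rwa [if_pos (show dbl z 0 = dbl z 2 from rfl)] at this
    · rintro ⟨l, ⟨⟨⟨φ, hφ, h⟩, hl⟩, hE⟩, rfl⟩
      obtain rfl : l = fun z => φ (dbl z) := funext h
      refine ⟨_, ⟨φ, ⟨mem_polFixing_coordDbl.2 ⟨hφ, hl⟩, fun z hz => ?_⟩, rfl⟩, rfl⟩
      split_ifs with hz02
      · have := hE _ (mem_of_mem_coordDbl (fun x => hKK (hK x)) hz hz02)
        exact this.trans (congrArg φ (eq_dbl hz02).symm)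
      · rfl
  · rintro _ ⟨φ, ⟨hφ, -⟩, rfl⟩ _ ⟨ψ, ⟨hψ, -⟩, rfl⟩ h
    refine Set.domRestrict_eq_domRestrict_iff.2 ?_
    rintro z (hz | ⟨y, hy, rfl⟩)
    · rw [(mem_polFixing_coordDbl.1 hφ).1.2 hz, (mem_polFixing_coordDbl.1 hψ).1.2 hz]
    · exact congrFun h ⟨y, hy⟩

theorem isPSubalgebra_binaryFamily [Finite A] (hp : p.Prime) (hc : HasConstants L A) (i : Fin 3)
    {K K' : Set (A × A)} {z : A × A} (hK : K ⊆ K')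
    (hG : MppDefinable p L (cylinder p L (coordDbl K'))) (hz : z ∈ K')
    (h : ∀ l, l ∈ binaryFamily p L A i ∧ Set.EqOn l (fun z => proj i (dbl z)) K →
      ∀ l', l' ∈ binaryFamily p L A i ∧ Set.EqOn l' (fun z => proj i (dbl z)) K →
      l z = l' z → Set.EqOn l l' K') :
    IsPSubalgebra p L ((fun l => l z) '' {l | l ∈ binaryFamily p L A i ∧
      Set.EqOn l (fun z => proj i (dbl z)) K}) := by
  convert isPSubalgebra_of_polFixing hp hc hG (coordDbl_mono hK) i (dbl_mem_coordDbl hz) ?_ using 1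
  · ext x
    constructor
    · rintro ⟨l, ⟨⟨φ, hφ, h⟩, hl⟩, rfl⟩
      obtain rfl : l = fun z => φ (dbl z) := funext h
      exact ⟨φ, mem_polFixing_coordDbl.2 ⟨hφ, hl⟩, rfl⟩
    · rintro ⟨φ, hφ, rfl⟩
      rw [mem_polFixing_coordDbl] at hφ
      exact ⟨fun z => φ (dbl z), ⟨⟨φ, hφ.1, fun _ => rfl⟩, hφ.2⟩, rfl⟩
  · intro φ hφ ψ hψ hφψ
    rw [mem_polFixing_coordDbl] at hφ hψ
    rintro y (hy | ⟨y, hy, rfl⟩)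
    · rw [hφ.1.2 hy, hψ.1.2 hy]
    · exact h _ ⟨⟨φ, hφ.1, fun _ => rfl⟩, hφ.2⟩ _ ⟨⟨ψ, hψ.1, fun _ => rfl⟩, hψ.2⟩ hφψ hy

variable (L A) in
/-- The elimination system of the triples `(x, y, x)` modulo 2. -/
def binarySystem (hA : Nat.card A = 3) (hc : HasConstants L A) : ElimSystem A (A × A) :=
  have := Nat.finite_of_card_ne_zero (α := A) (by omega)
  have hp := Nat.prime_two
  { p := fun z => proj 0 (dbl z)
    q := fun z => proj 1 (dbl z)
    pair := Prod.mk
    p_pair := fun _ _ => rfl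
    q_pair := fun _ _ => rfl
    pair_eta := fun _ => rfl
    LL := binaryFamily 2 L A 0
    RR := binaryFamily 2 L A 1
    p_mem := proj_mem_binaryFamily 0
    q_mem := proj_mem_binaryFamily 1
    idem_LL := fun _ hl => binaryFamily_idem hl
    idem_RR := fun _ hl => binaryFamily_idem hl
    comp_LL := fun _ hf _ hl _ hr => binaryFamily_comp hp hf hl hr
    comp_RR := fun _ hf _ hl _ hr => binaryFamily_comp hp hf hl hr
    closed_LL := fun _ hf _ hl _ hl' => hf.elim (fun hf => binaryFamily_closed hp hf hl hl')
      fun hf => binaryFamily_closed hp hf hl hl'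
    closed_RR := fun _ hf _ hl _ hl' => hf.elim (fun hf => binaryFamily_closed hp hf hl hl')
      fun hf => binaryFamily_closed hp hf hl hl'
    G := fun K => MppDefinable 2 L (cylinder 2 L (coordDbl K))
    Sub := fun B => IsPSubalgebra 2 L B
    G_univ := mppDefinable_cylinder_dbl hA hp
    elim := by
      classical
      intro K K' E hK hKK hG hE hL hR
      refine mppDefinable_cylinder_of_subset hp (coordDbl_mono hKK) hG
        (fun z => if z 0 = z 2 then dbl (E (z 0, z 1)) else z) (fun z hz => ?_) fun i => ?_
      · split_ifs with h
        · exact dbl_mem_coordDbl (hE _ (mem_of_mem_coordDbl (fun x => hKK (hK x)) hz h))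
        · exact hz
      · refine Odd.not_two_dvd_nat ?_
        rw [ncard_domRestrict_coordDbl hK hKK]
        fin_cases i
        · exact hL
        · exact hR
        · have h2 := binaryFamily_two (L := L) (A := A) hp
          change Odd (K'.domRestrict '' {l | (l ∈ binaryFamily 2 L A 2 ∧
            Set.EqOn l (fun z => proj 2 (dbl z)) K) ∧ ∀ z ∈ K', l (E z) = l z}).ncard
          rw [h2]
          exact hL
    sub_LL := fun _ _ _ h1 h2 h3 h4 => isPSubalgebra_binaryFamily hp hc 0 h1 h2 h3 h4
    sub_RR := fun _ _ _ h1 h2 h3 h4 => isPSubalgebra_binaryFamily hp hc 1 h1 h2 h3 h4 }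

theorem isPolymorphism_basic_of_ternaryPol (hp : p.Prime) {φ : (Fin 3 → A) → A}
    (hφ : φ ∈ ternaryPol p L A) (ρ : Fin 3 → Fin 2) :
    IsPolymorphism (fun x : Fin 2 → A => φ fun j => x (ρ j)) (basicRelations L A) :=
  fun R hR t ht => hφ R (basicRelations_subset_mppRelations hp hR) (fun j => t (ρ j))
    fun j => ht (ρ j)

theorem automorphic_of_swap {f : (Fin 2 → A) → A} (hf : IsPolymorphism f (basicRelations L A))
    {a b c : A} (hab : a ≠ b) (hac : a ≠ c) (hbc : b ≠ c) (hcov : ∀ x, x = a ∨ x = b ∨ x = c)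
    (hsub : IsPSubalgebra 2 L ({a, b} : Set A)) (ha : f ![c, a] = b) (hb : f ![c, b] = a)
    (hc : f ![c, c] = c) (h : ∀ x y, x ≠ c → f ![x, y] = y) :
    ∃ f : (Fin 2 → A) → A, IsPAutomorphicPolynomial 2 L f ∧
        ∃ a : A, IsPermOfOrder f a 2 ∧ IsPSubalgebra 2 L ({a}ᶜ : Set A) := by
  classical
  have hperm : IsPermOfOrder f c 2 := by
    refine ⟨Equiv.swap a b, fun x => ?_, ?_⟩
    · rcases hcov x with rfl | rfl | rfl
      · rw [Equiv.swap_apply_left, ha]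
      · rw [Equiv.swap_apply_right, hb]
      · rw [Equiv.swap_apply_of_ne_of_ne hac.symm hbc.symm, hc]
    · refine orderOf_eq_prime ?_ ?_
      · rw [sq, Equiv.swap_mul_self]
      · rwa [Ne, Equiv.swap_eq_one_iff]
  refine ⟨f, ⟨hf, fun x => ?_, c, hperm⟩, c, hperm, ?_⟩
  · by_cases hx : x = c
    · exact Or.inr (hx ▸ hperm)
    · exact Or.inl fun y => h x y hx
  · convert hsub using 1
    ext x
    have := hcov x
    simp only [Set.mem_compl_iff, Set.mem_singleton_iff, Set.mem_insert_iff]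
    constructor
    · tauto
    · rintro (rfl | rfl) <;> assumption

theorem mppDefinable_cylinder_or_automorphic (hA : Nat.card A = 3) (hc : HasConstants L A) :
    MppDefinable 2 L (cylinder 2 L (coordI A ∪ coordJ A)) ∨
    ∃ f : (Fin 2 → A) → A, IsPAutomorphicPolynomial 2 L f ∧
        ∃ a : A, IsPermOfOrder f a 2 ∧ IsPSubalgebra 2 L ({a}ᶜ : Set A) := by
  have := Nat.finite_of_card_ne_zero (α := A) (by omega)
  rcases (binarySystem L A hA hc).G_diagonal_or_exists_swap hA with
    h | ⟨a, b, c, hab, hac, hbc, hcov, hsub, ⟨r, hr, h1, h2, h3⟩ | ⟨l, hl, h1, h2, h3⟩⟩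
  · left
    have hW : coordDbl (Set.range fun x : A => (x, x)) = coordI A ∪ coordJ A := by
      refine Set.union_eq_left.2 ?_
      rintro _ ⟨_, ⟨x, rfl⟩, rfl⟩
      exact triple_left_mem x x
    rw [← hW]
    exact h
  · right
    have hid := binaryFamily_idem hr
    obtain ⟨φ, hφ, hrφ⟩ := hr
    have key : ∀ x y, φ (fun j => (![x, y] : Fin 2 → A) ((![0, 1, 0] : Fin 3 → Fin 2) j)) =
        r (x, y) := by
      intro x y
      rw [hrφ]
      congr 1
      funext j
      fin_cases j <;> rfl
    refine automorphic_of_swap (isPolymorphism_basic_of_ternaryPol Nat.prime_two hφ.1 ![0, 1, 0])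
      hab hac hbc hcov hsub ((key _ _).trans h1) ((key _ _).trans h2) ((key _ _).trans (hid c))
      fun x y hx => (key _ _).trans (h3 (x, y) hx)
  · right
    have hid := binaryFamily_idem hl
    obtain ⟨φ, hφ, hlφ⟩ := hl
    have key : ∀ x y, φ (fun j => (![x, y] : Fin 2 → A) ((![1, 0, 1] : Fin 3 → Fin 2) j)) =
        l (y, x) := by
      intro x y
      rw [hlφ]
      congr 1
      funext j
      fin_cases j <;> rfl
    -- In the first family the parameter is the second argument, so the polynomial is (x,y) ↦
    -- φ(y,x,y).
    refine automorphic_of_swap (isPolymorphism_basic_of_ternaryPol Nat.prime_two hφ.1 ![1, 0, 1])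
      hab hac hbc hcov hsub ((key _ _).trans h1) ((key _ _).trans h2) ((key _ _).trans (hid c))
      fun x y hx => (key _ _).trans (h3 (y, x) hx)

end Binary

end ModCSP

theorem theorem4p9 {L : FirstOrder.Language.{u, v}} [L.IsRelational] [Finite L.Symbols]
    {A : Type w} [L.Structure A] (hA : Nat.card A = 3) (hconst : ModCSP.HasConstants L A)
    {p : ℕ} (hp : p.Prime) :
    (ModCSP.HasMaltsevPolymorphism (ModCSP.mppRelations p L A) ∧
        ModCSP.StronglyPRectangular p L A) ∨
      ModCSP.AdmitsIndicatorObstruction p L A ∨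
      (p = 2 ∧ ∃ f : (Fin 2 → A) → A, ModCSP.IsPAutomorphicPolynomial p L f ∧
        ∃ a : A, ModCSP.IsPermOfOrder f a 2 ∧ ModCSP.IsPSubalgebra p L ({a}ᶜ : Set A)) := by
  have := Nat.finite_of_card_ne_zero (α := A) (by omega)
  have : Nonempty A := (Nat.card_ne_zero.1 (by omega : Nat.card A ≠ 0)).1
  by_cases hm : ModCSP.HasMaltsevPolymorphism (ModCSP.mppRelations p L A)
  · exact Or.inl ⟨hm, ModCSP.stronglyPRectangular_of_hasMaltsevPolymorphism hm⟩
  right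
  by_cases hp2 : p = 2
  · subst hp2
    rcases ModCSP.mppDefinable_cylinder_or_automorphic (L := L) hA hconst with h | h
    · exact Or.inl (ModCSP.admitsIndicatorObstruction_of_mppDefinable hp h hm)
    · exact Or.inr ⟨rfl, h⟩
  · exact Or.inl (ModCSP.admitsIndicatorObstruction_of_mppDefinable hp
      (ModCSP.mppDefinable_cylinder_of_odd hA hp hp2) hm)
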